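/- Let $n\ge 2$ and write $\mathbf z=\sum_{i=1}^n|z_i|^2$ on $\mathbb C^n$. On $\mathbb C^n\setminus\{0\}$ let $g_{\mathbb{CP}^{n-1}}$ and $h$ be the pull-backs of the Fubini–Study metric and of the metric along the Hopf fibre of $S^{2n-1}$, so that $g_{S^{2n-1}}=g_{\mathbb{CP}^{n-1}}+h$ and the flat metric is $(d\sqrt{\mathbf z})^2+\mathbf z\,(g_{\mathbb{CP}^{n-1}}+h)$. Let $\mathscr F$ be a function of $\mathbf z$ that is smooth on $\mathbb C^n$ and positive on $\mathbb C^n\setminus\{0\}$, and whose first nonzero term in the Taylor expansion in $\mathbf z$ at $0$ is of order $k\ge 0$. Let $\int\frac{d\mathbf z}{\mathbf z^n\mathscr F^{n-1}}$ denote any fixed antiderivative on $(0,\infty)$, let $\mathcal C\in\mathbb R$, and suppose that $(\mathscr F,\mathcal C)$ is admissible on $\mathbb C^n\setminus\{0\}$, i.e. that $$\mathbf z\mathscr F\cdot\Big(\frac1{2n-1}\int\frac{d\mathbf z}{\mathbf z^n\mathscr F^{n-1}}+\mathcal C\Big)^{-2}$$ is strictly increasing in $\mathbf z\in(0,\infty)$.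 Let $$g_{(\mathscr F,\mathcal C)}=\Big((\mathbf z\mathscr F)'-\frac{2}{\mathbf z^{n-1}\mathscr F^{n-2}}\Big(\int\frac{d\mathbf z}{\mathbf z^n\mathscr F^{n-1}}+(2n-1)\mathcal C\Big)^{-1}\Big)\big((d\sqrt{\mathbf z})^2+\mathbf z h\big)+\mathbf z\mathscr F\,g_{\mathbb{CP}^{n-1}}$$ on $\mathbb C^n\setminus\{0\}$. (1) The metric extends over the origin with an asymptotically cone-like singularity: $r\ge 0$ with $r^2=\frac{2n-1}{k+1}\frac{\mathscr F^{(k)}(0)}{k!}\mathbf z^{k+1}$ is a change of the radial variable (an increasing homeomorphism of $[0,\infty)$, and a diffeomorphism of $(0,\infty)$), and $$g_{(\mathscr F,\mathcal C)}=dr^2+\frac{k+1}{2n-1}\,r^2\big(g_{\mathbb{CP}^{n-1}}+(k+1)(2n-1)h\big)+a(r)\,dr^2+b(r)\,h+c(r)\,g_{\mathbb{CP}^{n-1}},$$ where the last three terms are of higher order: $a=o(1)$, $b=o(r^2)$ and $c=o(r^2)$ as $r\to0^+$. More precisely $c=O(r^{2(k+2)/(k+1)})$ and, unless $(n,k)=(2,0)$,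 also $a=O(r^{2/(k+1)})$ and $b=O(r^{2(k+2)/(k+1)})$. (2) Say that this extension is of class $C^\ell$ over the origin if $a,b,c$, with suitable values at $r=0$, are of class $C^\ell$ in the variable $r$ on $[0,\varepsilon)$ for some $\varepsilon>0$. - If $k=0$ or $k=1$, it is of class $C^\infty$ if $\frac{\partial^{(k+1)(n-1)}}{\partial\mathbf z^{(k+1)(n-1)}}\big(\frac{\mathbf z^k}{\mathscr F}\big)^{n-1}\big|_{\mathbf z=0}=0$ (where $\mathbf z^k/\mathscr F$ is extended smoothly over $\mathbf z=0$), and otherwise it is of class $C^{2n-3}$ but not of class $C^{2n-2}$. - If $k\ge 2$, it is of class $C^0$, and no more can be guaranteed a priori: for all $n\ge2$ and $k\ge2$ there is an admissible pair as above for which it is not of class $C^1$. -/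

import Mathlib

open scoped ContDiff Topology Asymptotics

namespace Klsc

/-- `ℂⁿ` with its Euclidean (Hermitian) structure. -/
abbrev Cn (n : ℕ) : Type := EuclideanSpace ℂ (Fin n)

/-- The radial variable `z = ∑ |zᵢ|²`. -/
noncomputable def radial {n : ℕ} (x : Cn n) : ℝ := ∑ i, ‖x i‖ ^ 2

/-- The symmetric 2-tensor `(df)²` of a real function `f` on `ℂⁿ`, at the point `x`, evaluated on
the real tangent vectors `u`, `v`. -/
noncomputable def sqDiff {n : ℕ} (f : Cn n → ℝ) (x u v : Cn n) : ℝ :=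
  fderiv ℝ f x u * fderiv ℝ f x v

/-- The metric `h` along the fibre of the Hopf fibration `S²ⁿ⁻¹ → ℂℙⁿ⁻¹`, pulled back to
`ℂⁿ ∖ {0}` by `x ↦ x / |x|`. -/
noncomputable def hopf {n : ℕ} (x u v : Cn n) : ℝ :=
  ((inner ℂ x u).im / ‖x‖ ^ 2) * ((inner ℂ x v).im / ‖x‖ ^ 2)

/-- The Fubini-Study metric of `ℂℙⁿ⁻¹`, pulled back to `ℂⁿ ∖ {0}` by `x ↦ [x]`; normalised so that
`h + g_{ℂℙⁿ⁻¹}` is the (pulled back) standard metric of the unit sphere `S²ⁿ⁻¹`. -/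
noncomputable def fubiniStudy {n : ℕ} (x u v : Cn n) : ℝ :=
  ((‖x‖ : ℂ) ^ 2 * inner ℂ u v - inner ℂ u x * inner ℂ x v).re / ‖x‖ ^ 4

/-- `P` is an indefinite integral `∫ dz / (zⁿ F(z)ⁿ⁻¹)` on `(0, ∞)`. -/
def IsAntiderivative (n : ℕ) (F P : ℝ → ℝ) : Prop :=
  ∀ z : ℝ, 0 < z → HasDerivAt P (1 / (z ^ n * F z ^ (n - 1))) z

/-- Admissibility of the pair `(F, C)` on `ℂⁿ ∖ {0}`, the indefinite integral in it being `P`: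
`F` is smooth and positive there and `z F (P / (2n-1) + C)⁻²` is strictly increasing.
(Strict monotonicity also forces `P / (2n-1) + C` to have no zero.) -/
def IsAdmissible (n : ℕ) (F P : ℝ → ℝ) (C : ℝ) : Prop :=
  ContDiffOn ℝ ∞ (fun x : Cn n => F (radial x)) {0}ᶜ ∧
  (∀ z : ℝ, 0 < z → 0 < F z) ∧
  StrictMonoOn (fun z : ℝ => z * F z * (1 / (2 * (n : ℝ) - 1) * P z + C) ^ (-2 : ℤ)) (Set.Ioi 0)

/-- The coefficient of `(d√z)² + z h` in `g_{(F, C)}`, equal to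
`(zF)' - 2 / (zⁿ⁻¹ Fⁿ⁻²) · (∫ dz / (zⁿ Fⁿ⁻¹) + (2n-1) C)⁻¹`. -/
noncomputable def coeff (n : ℕ) (F P : ℝ → ℝ) (C z : ℝ) : ℝ :=
  deriv (fun t => t * F t) z
    - 2 / (z ^ (n - 1) * F z ^ (n - 2)) * (P z + (2 * (n : ℝ) - 1) * C)⁻¹

/-- The `U(n)`-invariant metric `g_{(F, C)}` at the point `x ≠ 0`, on real tangent vectors. -/
noncomputable def metric (n : ℕ) (F P : ℝ → ℝ) (C : ℝ) (x u v : Cn n) : ℝ :=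
  coeff n F P C (radial x)
      * (sqDiff (fun y : Cn n => √(radial y)) x u v + radial x * hopf x u v)
    + radial x * F (radial x) * fubiniStudy x u v

/-- The Taylor coefficient `F⁽ʲ⁾(0) / j!` of a function `F` on `[0, ∞)`. -/
noncomputable def taylorCoeff (F : ℝ → ℝ) (j : ℕ) : ℝ :=
  iteratedDerivWithin j F (Set.Ici 0) 0 / (j.factorial : ℝ)

/-- The first nonzero term in the Taylor expansion of `F` at `0` is the one of order `k`. -/
def HasOrder (F : ℝ → ℝ) (k : ℕ) : Prop :=
  (∀ j < k, taylorCoeff F j = 0) ∧ taylorCoeff F k ≠ 0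

/-- `(zᵏ / F)ⁿ⁻¹` on `[0, ∞)`, with the removable singularity at `0` removed. -/
noncomputable def quotPow (n k : ℕ) (F : ℝ → ℝ) (z : ℝ) : ℝ :=
  (if z = 0 then (taylorCoeff F k)⁻¹ else z ^ k / F z) ^ (n - 1)

/-- The `(k+1)(n-1)`-th derivative of `(zᵏ / F)ⁿ⁻¹` at `z = 0`. -/
noncomputable def obstruction (n k : ℕ) (F : ℝ → ℝ) : ℝ :=
  iteratedDerivWithin ((k + 1) * (n - 1)) (quotPow n k F) (Set.Ici 0) 0

/-- The new radial variable `r`, as a function of `z`: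
`r² = (2n-1)/(k+1) · F⁽ᵏ⁾(0)/k! · zᵏ⁺¹`. -/
noncomputable def coneRadius (n k : ℕ) (F : ℝ → ℝ) (z : ℝ) : ℝ :=
  √((2 * (n : ℝ) - 1) / ((k : ℝ) + 1) * taylorCoeff F k * z ^ (k + 1))

/-- `r` is a change of the radial variable `z`: a homeomorphism of `[0, ∞)` which is an orientation
preserving diffeomorphism of `(0, ∞)`. -/
def IsRadialChange (r : ℝ → ℝ) : Prop :=
  Set.BijOn r (Set.Ici 0) (Set.Ici 0) ∧ StrictMonoOn r (Set.Ici 0) ∧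
  ContinuousOn r (Set.Ici 0) ∧ ContDiffOn ℝ ∞ r (Set.Ioi 0) ∧ ∀ z : ℝ, 0 < z → 0 < deriv r z

/-- On `ℂⁿ ∖ {0}`,
`g = dr² + (k+1)/(2n-1) r² (g_{ℂℙⁿ⁻¹} + (k+1)(2n-1) h) + (a(r) dr² + b(r) h + c(r) g_{ℂℙⁿ⁻¹})`. -/
def IsConeExpansion (n k : ℕ) (g : Cn n → Cn n → Cn n → ℝ) (r : ℝ → ℝ) (a b c : ℝ → ℝ) : Prop :=
  ∀ x : Cn n, x ≠ 0 → ∀ u v : Cn n,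
    g x u v =
      sqDiff (fun y : Cn n => r (radial y)) x u v
        + ((k : ℝ) + 1) / (2 * (n : ℝ) - 1) * r (radial x) ^ 2
          * (fubiniStudy x u v + ((k : ℝ) + 1) * (2 * (n : ℝ) - 1) * hopf x u v)
        + (a (r (radial x)) * sqDiff (fun y : Cn n => r (radial y)) x u v
          + b (r (radial x)) * hopf x u v
          + c (r (radial x)) * fubiniStudy x u v)

/-- `f` is of class `C^ℓ` in the variable `r ≥ 0` near, and up to, `r = 0`. -/
def OfClassAtZero (ℓ : ℕ∞) (f : ℝ → ℝ) : Prop :=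
  ∃ ε : ℝ, 0 < ε ∧ ContDiffOn ℝ (ℓ : WithTop ℕ∞) f (Set.Ico 0 ε)

/-- The extension of `g` over the origin is of class `C^ℓ`: all coefficients of its remainder over
the cone model are (after being given a value at `r = 0`) of class `C^ℓ` in `r` up to `r = 0`. -/
def HasClass (n k : ℕ) (g : Cn n → Cn n → Cn n → ℝ) (r : ℝ → ℝ) (ℓ : ℕ∞) : Prop :=
  ∃ a b c : ℝ → ℝ, IsConeExpansion n k g r a b c ∧
    OfClassAtZero ℓ a ∧ OfClassAtZero ℓ b ∧ OfClassAtZero ℓ c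

end Klsc

/-! Everything reduces to one function of `z`. Write `F = zᵏ G` with `G` smooth and positive on `[0,
∞)`, and put `N = (k+1)(n-1)`. The integrand is then `G^{-(n-1)} / z^{N+1}`. Integrating its Taylor
expansion gives `P + (2n-1)C = (W + κ zᴺ log z) / zᴺ`, with `W` smooth and `W(0) =
-G(0)^{-(n-1)}/N`. Here `κ` is the `N`-th Taylor coefficient of `(zᵏ/F)ⁿ⁻¹`, that is, the
obstruction divided by `N!`. The integration constant and `C` only change `W` by a multiple of `zᴺ`.

The coefficient of `(d√z)² + z h` is therefore `zᵏ E(z)`, where `E` (`profile`) is smooth apart from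
the term `κ zᴺ log z`. Since `E(0) = (k+1)(2n-1)G(0)`, the leading part of the metric is the stated
cone, and the remainders are `a = E/E(0) - 1`, `b = (k+1)² r² a` and `c = r² (G - G(0))/β`, where
`r² = β zᵏ⁺¹` (`IsNormalForm.isConeExpansion`).

Regularity in `r` has two sources. The substitution `z = (r²/β)^{1/(k+1)}` is smooth on `r ≥ 0` for
`k = 0, 1`. The logarithm becomes `r²ⁿ⁻²(p + q log r)`, which is `C²ⁿ⁻³` but not `C²ⁿ⁻²` when `q ≠
0`. The metric determines `a` for `r > 0`, and the log term can be recovered from `a`, so no choice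
of remainders does better (`IsNormalForm.not_hasClass`). For `k ≥ 2`, a nonzero linear term of `E`
puts `r^{2/(k+1)}`, with exponent below 1, into `a`; an explicit `F` exhibits this
(`IsNormalForm.not_hasClass_one`). -/

namespace Klsc

open Set Filter

/-! ### Smooth functions on the half-line -/

/-- Differentiation under the integral sign over `[0, 1]`. -/
theorem hasDerivAt_integral_unitInterval {f f' : ℝ → ℝ → ℝ}
    (hf : Continuous f.uncurry) (hf' : Continuous f'.uncurry)
    (hd : ∀ x s, HasDerivAt (fun y => f y s) (f' x s) x) (x : ℝ) :
    HasDerivAt (fun y => ∫ s in (0 : ℝ)..1, f y s) (∫ s in (0 : ℝ)..1, f' x s) x := by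
  obtain ⟨M, hM⟩ := ((isCompact_closedBall x 1).prod (isCompact_Icc (a := (0 : ℝ)) (b := 1))
    |>.exists_bound_of_continuousOn hf'.continuousOn)
  have hc : ∀ y, Continuous (f y) := fun y => hf.comp (by fun_prop : Continuous fun s => (y, s))
  have hc' : ∀ y, Continuous (f' y) := fun y => hf'.comp (by fun_prop : Continuous fun s => (y, s))
  refine (intervalIntegral.hasDerivAt_integral_of_dominated_loc_of_deriv_le
    (bound := fun _ => M) (Metric.ball_mem_nhds x one_pos)
    (Eventually.of_forall fun y => (hc y).aestronglyMeasurable) ((hc x).intervalIntegrable _ _)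
    (hc' x).aestronglyMeasurable ?_ (by simp) ?_).2
  · refine Eventually.of_forall fun s hs y hy => ?_
    rw [uIoc_of_le zero_le_one] at hs
    exact hM (y, s) ⟨Metric.ball_subset_closedBall hy, ⟨hs.1.le, hs.2⟩⟩
  · exact Eventually.of_forall fun s _ y _ => hd y s

/-- Differentiating under the integral replaces `f` by `f'` and raises the weight `s ^ j` by one
power, so the induction must cover all `j`. -/
theorem contDiff_integral_pow_mul_comp_mul (m : ℕ) :
    ∀ (j : ℕ) (f : ℝ → ℝ), ContDiff ℝ ∞ f →
      ContDiff ℝ m (fun t => ∫ s in (0 : ℝ)..1, s ^ j * f (t * s)) := by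
  induction m with
  | zero =>
    intro j f hf
    have := hf.continuous
    refine contDiff_zero.2 ?_
    exact intervalIntegral.continuous_parametric_intervalIntegral_of_continuous'
      (f := fun t s => s ^ j * f (t * s)) (by fun_prop) 0 1
  | succ m ih =>
    intro j f hf
    have hfc := hf.continuous
    have hf' : ContDiff ℝ ∞ (deriv f) := (contDiff_infty_iff_deriv.1 hf).2
    have hfc' := hf'.continuous
    have key : ∀ t, HasDerivAt (fun t => ∫ s in (0 : ℝ)..1, s ^ j * f (t * s))
        (∫ s in (0 : ℝ)..1, s ^ (j + 1) * deriv f (t * s)) t := by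
      refine hasDerivAt_integral_unitInterval (f := fun t s => s ^ j * f (t * s))
        (f' := fun t s => s ^ (j + 1) * deriv f (t * s)) (by fun_prop) (by fun_prop) ?_
      intro x s
      have h1 : HasDerivAt f (deriv f (x * s)) (x * s) :=
        ((contDiff_infty_iff_deriv.1 hf).1 _).hasDerivAt
      have h2 := (h1.comp x ((hasDerivAt_id x).mul_const s)).const_mul (s ^ j)
      refine h2.congr_deriv ?_
      ring
    push_cast
    rw [contDiff_succ_iff_deriv]
    refine ⟨fun t => (key t).differentiableAt, by simp, ?_⟩
    rw [show deriv _ = _ from funext fun t => (key t).deriv]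
    exact ih (j + 1) _ hf'

/-- **Hadamard's lemma** on the line. -/
theorem exists_contDiff_eq_add_mul {f : ℝ → ℝ} (hf : ContDiff ℝ ∞ f) :
    ∃ g : ℝ → ℝ, ContDiff ℝ ∞ g ∧ ∀ t, f t = f 0 + t * g t := by
  have hf' := contDiff_infty_iff_deriv.1 hf
  refine ⟨fun t => ∫ s in (0 : ℝ)..1, deriv f (t * s), ?_, fun t => ?_⟩
  · refine contDiff_infty.2 fun m => ?_
    simpa using contDiff_integral_pow_mul_comp_mul m 0 _ hf'.2
  · have hd : ∀ s ∈ uIcc (0 : ℝ) 1,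
        HasDerivAt (fun s => f (t * s)) (t * deriv f (t * s)) s := by
      intro s _
      have h2 := (hf'.1 (t * s)).hasDerivAt.comp s ((hasDerivAt_id s).const_mul t)
      exact h2.congr_deriv (by ring)
    have := hf'.2.continuous
    have h := intervalIntegral.integral_eq_sub_of_hasDerivAt hd
      ((by fun_prop : Continuous fun s => t * deriv f (t * s)).intervalIntegrable _ _)
    rw [intervalIntegral.integral_const_mul] at h
    rw [h]
    simp

theorem apply_sqrt_sq_of_even {g : ℝ → ℝ} (hg : ∀ t, g (-t) = g t) (t : ℝ) :
    g (√(t ^ 2)) = g t := by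
  rw [Real.sqrt_sq_eq_abs]
  rcases abs_choice t with h | h <;> simp [h, hg]

/-- At the endpoint, the one-sided derivative is the limit of the derivatives from the right. -/
theorem hasDerivWithinAt_Ici_of_Ioi {F F' : ℝ → ℝ} (hF : ContinuousOn F (Ici 0))
    (hF' : ContinuousOn F' (Ici 0)) (hd : ∀ z, 0 < z → HasDerivAt F (F' z) z) :
    ∀ z ∈ Ici (0 : ℝ), HasDerivWithinAt F (F' z) (Ici 0) z := by
  intro z hz
  rcases eq_or_lt_of_le (mem_Ici.1 hz) with rfl | hz
  · refine hasDerivWithinAt_Ici_of_tendsto_deriv (s := Ioi 0)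
      (fun z hz => (hd z hz).differentiableAt.differentiableWithinAt)
      ((hF 0 self_mem_Ici).mono Ioi_subset_Ici_self) self_mem_nhdsWithin ?_
    refine ((hF' 0 self_mem_Ici).mono Ioi_subset_Ici_self).tendsto.congr' ?_
    filter_upwards [self_mem_nhdsWithin] with z hz using (hd z hz).deriv.symm
  · exact (hd z hz).hasDerivWithinAt

theorem contDiffOn_Ici_succ_of_Ioi {F F' : ℝ → ℝ} {m : ℕ} (hF : ContinuousOn F (Ici 0))
    (hF' : ContDiffOn ℝ m F' (Ici 0)) (hd : ∀ z, 0 < z → HasDerivAt F (F' z) z) :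
    ContDiffOn ℝ (m + 1) F (Ici 0) := by
  have h := hasDerivWithinAt_Ici_of_Ioi hF hF'.continuousOn hd
  rw [contDiffOn_succ_iff_derivWithin (uniqueDiffOn_Ici 0)]
  refine ⟨fun z hz => (h z hz).differentiableWithinAt, by simp, hF'.congr fun z hz => ?_⟩
  exact (h z hz).derivWithin (uniqueDiffOn_Ici 0 z hz)

/-- **Whitney's theorem** on even functions: if `t ↦ F (t²)` is smooth, then `F` is smooth on
`[0, ∞)`. -/
theorem contDiffOn_Ici_of_comp_sq {F : ℝ → ℝ} (hF : ContDiff ℝ ∞ fun t => F (t ^ 2)) :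
    ContDiffOn ℝ ∞ F (Ici 0) := by
  refine contDiffOn_infty.2 fun m => ?_
  have hcont : ∀ {F : ℝ → ℝ}, (ContDiff ℝ ∞ fun t => F (t ^ 2)) → ContinuousOn F (Ici 0) := by
    intro F hF
    refine ((hF.continuous.comp Real.continuous_sqrt).continuousOn).congr fun z hz => ?_
    simp [Real.sq_sqrt (mem_Ici.1 hz)]
  induction m generalizing F with
  | zero => exact contDiffOn_zero.2 (hcont hF)
  | succ m ih =>
    have hf' := contDiff_infty_iff_deriv.1 hF
    set f : ℝ → ℝ := fun t => F (t ^ 2) with hfdef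
    obtain ⟨g, hg, hfg⟩ := exists_contDiff_eq_add_mul hf'.2
    -- As `f` is even, `f'` is odd, so `f' = 2 t e` with `e` even; then `F'(z) = e(√z)`, and
    -- `e(√(t²)) = e(t)` is smooth, so the induction applies to `F'`.
    set e : ℝ → ℝ := fun t => (g t + g (-t)) / 4 with he
    have hodd : ∀ t, deriv f (-t) = -deriv f t := by
      intro t
      have := deriv_comp_neg f t
      rw [show (fun x => f (-x)) = f from by funext x; simp [hfdef]] at this
      linarith
    have hfe : ∀ t, deriv f t = 2 * t * e t := by
      intro t
      have h1 := hfg t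
      have h2 := hfg (-t)
      rw [hodd] at h2
      simp only [he]
      linarith
    have hees : ∀ t, e (√(t ^ 2)) = e t :=
      apply_sqrt_sq_of_even fun t => by simp [he, add_comm]
    have hes : ContDiff ℝ ∞ fun t => (fun z => e (√z)) (t ^ 2) := by
      simp only [hees]
      exact (hg.add (hg.comp contDiff_neg)).div_const 4
    push_cast
    refine contDiffOn_Ici_succ_of_Ioi (hcont hF) (ih (F := fun z => e (√z)) hes) fun z hz => ?_
    have hs : 0 < √z := Real.sqrt_pos.2 hz
    have h1 := (hf'.1 (√z)).hasDerivAt.comp z (Real.hasDerivAt_sqrt hz.ne')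
    have h2 : (f ∘ fun z => √z) =ᶠ[𝓝 z] F := by
      filter_upwards [eventually_gt_nhds hz] with y hy
      simp [hfdef, Real.sq_sqrt hy.le]
    refine (h1.congr_of_eventuallyEq h2.symm).congr_deriv ?_
    rw [hfe]
    field_simp

theorem contDiff_comp_sq {F : ℝ → ℝ} (hF : ContDiffOn ℝ ∞ F (Ici 0)) :
    ContDiff ℝ ∞ fun t => F (t ^ 2) :=
  hF.comp_contDiff (by fun_prop) fun t => sq_nonneg t

/-- **Hadamard's lemma** on the half-line. -/
theorem exists_contDiffOn_Ici_eq_add_mul {F : ℝ → ℝ} (hF : ContDiffOn ℝ ∞ F (Ici 0)) :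
    ∃ G : ℝ → ℝ, ContDiffOn ℝ ∞ G (Ici 0) ∧ ∀ z, 0 ≤ z → F z = F 0 + z * G z := by
  obtain ⟨g₁, hg₁, h₁⟩ := exists_contDiff_eq_add_mul (contDiff_comp_sq hF)
  obtain ⟨g₂, hg₂, h₂⟩ := exists_contDiff_eq_add_mul hg₁
  -- Averaging the second-order expansion of `F(t²)` over `±t` cancels its linear term.
  set e : ℝ → ℝ := fun t => (g₂ t + g₂ (-t)) / 2 with he
  have hee : ∀ t, e (√(t ^ 2)) = e t :=
    apply_sqrt_sq_of_even fun t => by simp [he, add_comm]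
  refine ⟨fun z => e (√z), contDiffOn_Ici_of_comp_sq ?_, fun z hz => ?_⟩
  · simp only [hee]
    exact (hg₂.add (hg₂.comp contDiff_neg)).div_const 2
  · have h3 := h₁ (√z)
    have h4 := h₁ (-√z)
    have h5 := h₂ (√z)
    have h6 := h₂ (-√z)
    have h7 := Real.sq_sqrt hz
    simp only [neg_sq, h7, ne_eq, OfNat.ofNat_ne_zero, not_false_eq_true, zero_pow] at h3 h4
    rw [h5] at h3
    rw [h6] at h4
    simp only [he]
    linear_combination h3 / 2 + h4 / 2 + (g₂ √z + g₂ (-√z)) / 2 * h7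

/-- A smooth function on `[0, ∞)` has a smooth primitive vanishing at `0`. -/
theorem exists_primitive_Ici {ψ : ℝ → ℝ} (hψ : ContDiffOn ℝ ∞ ψ (Ici 0)) :
    ∃ W : ℝ → ℝ, ContDiffOn ℝ ∞ W (Ici 0) ∧ ∀ z, 0 < z → HasDerivAt W (ψ z) z := by
  -- Extending `ψ` by a constant to negative arguments makes the fundamental theorem of calculus
  -- two-sided at `0`.
  have hc : Continuous fun z => ψ (max z 0) :=
    hψ.continuousOn.comp_continuous (by fun_prop) fun z => le_max_right z 0
  have hd : ∀ z, HasDerivAt (fun y => ∫ t in (0 : ℝ)..y, ψ (max t 0)) (ψ (max z 0)) z :=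
    fun z => (hc.integral_hasStrictDerivAt 0 z).hasDerivAt
  have hd' : ∀ z, 0 < z → HasDerivAt (fun y => ∫ t in (0 : ℝ)..y, ψ (max t 0)) (ψ z) z := by
    intro z hz
    simpa [max_eq_left hz.le] using hd z
  refine ⟨_, contDiffOn_infty.2 fun m => ?_, hd'⟩
  have hcont : ContinuousOn (fun y => ∫ t in (0 : ℝ)..y, ψ (max t 0)) (Ici 0) :=
    fun z _ => (hd z).continuousAt.continuousWithinAt
  exact (contDiffOn_Ici_succ_of_Ioi hcont (contDiffOn_infty.1 hψ m) hd').of_le (by simp)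

/-! ### Taylor coefficients at the origin -/

theorem contDiffOn_Ici_hasDerivAt {F : ℝ → ℝ} (hF : ContDiffOn ℝ ∞ F (Ici 0)) {z : ℝ}
    (hz : 0 < z) : HasDerivAt F (derivWithin F (Ici 0) z) z := by
  have h := (hF.differentiableOn (by simp) z hz.le).hasDerivWithinAt
  exact h.hasDerivAt (Ici_mem_nhds hz)

theorem contDiffOn_Ici_derivWithin {F : ℝ → ℝ} (hF : ContDiffOn ℝ ∞ F (Ici 0)) :
    ContDiffOn ℝ ∞ (derivWithin F (Ici 0)) (Ici 0) :=
  ((contDiffOn_infty_iff_derivWithin (uniqueDiffOn_Ici 0)).1 hF).2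

theorem taylorCoeff_congr {F G : ℝ → ℝ} (h : EqOn F G (Ici 0)) (j : ℕ) :
    taylorCoeff F j = taylorCoeff G j := by
  rw [taylorCoeff, taylorCoeff, iteratedDerivWithin_congr h self_mem_Ici]

theorem taylorCoeff_zero (F : ℝ → ℝ) : taylorCoeff F 0 = F 0 := by
  simp [taylorCoeff]

/-- The derivative of `c + zψ` is `ψ + zψ'`, so the claim for `ψ` follows from the one for `ψ'`. -/
theorem iteratedDerivWithin_succ_add_id_mul (N : ℕ) :
    ∀ {ψ : ℝ → ℝ}, ContDiffOn ℝ ∞ ψ (Ici 0) → ∀ c : ℝ,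
      iteratedDerivWithin (N + 1) (fun z => c + z * ψ z) (Ici 0) 0 =
        (N + 1) * iteratedDerivWithin N ψ (Ici 0) 0 := by
  induction N with
  | zero =>
    intro ψ hψ c
    have h := (hψ.differentiableOn (by simp) 0 self_mem_Ici).hasDerivWithinAt
    have h2 := ((hasDerivWithinAt_id (0 : ℝ) (Ici 0)).mul h).const_add c
    rw [iteratedDerivWithin_succ']
    simp only [iteratedDerivWithin_zero]
    have := h2.derivWithin (uniqueDiffOn_Ici 0 0 self_mem_Ici)
    simpa using this
  | succ N ih =>
    intro ψ hψ c
    have hψ' := contDiffOn_Ici_derivWithin hψ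
    rw [iteratedDerivWithin_succ']
    have h1 : EqOn (derivWithin (fun z => c + z * ψ z) (Ici 0))
        (fun z => ψ z + (0 + z * derivWithin ψ (Ici 0) z)) (Ici 0) := by
      intro z hz
      have h := (hψ.differentiableOn (by simp) z hz).hasDerivWithinAt
      have h2 := ((hasDerivWithinAt_id z (Ici 0)).mul h).const_add c
      have := h2.derivWithin (uniqueDiffOn_Ici 0 z hz)
      simpa using this
    have hid : ContDiffOn ℝ ∞ (fun z => 0 + z * derivWithin ψ (Ici 0) z) (Ici 0) :=
      contDiffOn_const.add (contDiffOn_id.mul hψ')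
    rw [iteratedDerivWithin_congr h1 self_mem_Ici,
      iteratedDerivWithin_fun_add self_mem_Ici (uniqueDiffOn_Ici 0)
        ((contDiffOn_infty.1 hψ _) 0 self_mem_Ici)
        ((contDiffOn_infty.1 hid _) 0 self_mem_Ici),
      ih hψ', ← iteratedDerivWithin_succ']
    push_cast
    ring

theorem taylorCoeff_succ_add_id_mul {F ψ : ℝ → ℝ} (hψ : ContDiffOn ℝ ∞ ψ (Ici 0)) {c : ℝ}
    (h : ∀ z, 0 ≤ z → F z = c + z * ψ z) (N : ℕ) :
    taylorCoeff F (N + 1) = taylorCoeff ψ N := by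
  rw [taylorCoeff_congr (G := fun z => c + z * ψ z) (fun z hz => h z hz), taylorCoeff, taylorCoeff,
    iteratedDerivWithin_succ_add_id_mul N hψ c, Nat.factorial_succ]
  push_cast
  field_simp

theorem taylorCoeff_add_pow_mul (i : ℕ) : ∀ {F G : ℝ → ℝ} (k : ℕ), ContDiffOn ℝ ∞ G (Ici 0) →
    (∀ z, 0 ≤ z → F z = z ^ k * G z) → taylorCoeff F (k + i) = taylorCoeff G i := by
  intro F G k hG hF
  induction k generalizing F with
  | zero => rw [zero_add]; exact taylorCoeff_congr (fun z hz => by simp [hF z hz]) i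
  | succ k ih =>
    have hs : ContDiffOn ℝ ∞ (fun z => z ^ k * G z) (Ici 0) := (contDiffOn_id.pow k).mul hG
    rw [show k + 1 + i = (k + i) + 1 by ring, taylorCoeff_succ_add_id_mul hs (c := 0)
      (fun z hz => by rw [hF z hz]; ring)]
    exact ih fun z _ => rfl

theorem hasOrder_of_eq_pow_mul {F G : ℝ → ℝ} {k : ℕ} (hG : ContDiffOn ℝ ∞ G (Ici 0))
    (hF : ∀ z, 0 ≤ z → F z = z ^ k * G z) (h0 : G 0 ≠ 0) : HasOrder F k := by
  constructor
  · intro j hj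
    obtain ⟨d, rfl⟩ := Nat.exists_eq_add_of_lt hj
    have h := taylorCoeff_add_pow_mul 0 (F := F) (G := fun z => z ^ (d + 1) * G z) j
      ((contDiffOn_id.pow (d + 1)).mul hG) fun z hz => by rw [hF z hz]; ring
    simpa [taylorCoeff_zero] using h
  · have := taylorCoeff_add_pow_mul 0 k hG hF
    rw [add_zero, taylorCoeff_zero] at this
    rwa [this]

theorem HasOrder.exists_eq_pow_mul {F : ℝ → ℝ} {k : ℕ} (hF : ContDiffOn ℝ ∞ F (Ici 0))
    (hk : HasOrder F k) : ∃ G : ℝ → ℝ, ContDiffOn ℝ ∞ G (Ici 0) ∧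
      (∀ z, 0 ≤ z → F z = z ^ k * G z) ∧ taylorCoeff F k = G 0 := by
  -- Each vanishing Taylor coefficient lets Hadamard's lemma split off one more factor `z`.
  suffices H : ∀ j ≤ k, ∃ G : ℝ → ℝ, ContDiffOn ℝ ∞ G (Ici 0) ∧
      ∀ z, 0 ≤ z → F z = z ^ j * G z by
    obtain ⟨G, hG, h⟩ := H k le_rfl
    have := taylorCoeff_add_pow_mul 0 k hG h
    exact ⟨G, hG, h, by rwa [add_zero, taylorCoeff_zero] at this⟩
  intro j
  induction j with
  | zero => exact fun _ => ⟨F, hF, by simp⟩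
  | succ j ih =>
    intro hj
    obtain ⟨G, hG, h⟩ := ih (by omega)
    have h0 := taylorCoeff_add_pow_mul 0 j hG h
    rw [add_zero, taylorCoeff_zero, hk.1 j (by omega)] at h0
    obtain ⟨H, hH, hGH⟩ := exists_contDiffOn_Ici_eq_add_mul hG
    refine ⟨H, hH, fun z hz => ?_⟩
    rw [h z hz, hGH z hz, ← h0]
    ring

/-- Primitives of `φ(z) / zᴺ⁺¹` with `φ` smooth on `[0, ∞)`. -/
theorem exists_primitive_div_pow (N : ℕ) : ∀ {φ : ℝ → ℝ}, ContDiffOn ℝ ∞ φ (Ici 0) →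
    ∃ W : ℝ → ℝ, ContDiffOn ℝ ∞ W (Ici 0) ∧ (N ≠ 0 → W 0 = -φ 0 / N) ∧
      ∀ z, 0 < z → HasDerivAt (fun y => W y / y ^ N + taylorCoeff φ N * Real.log y)
        (φ z / z ^ (N + 1)) z := by
  induction N with
  | zero =>
    intro φ hφ
    obtain ⟨ψ, hψ, h⟩ := exists_contDiffOn_Ici_eq_add_mul hφ
    obtain ⟨W, hW, hd⟩ := exists_primitive_Ici hψ
    refine ⟨W, hW, by simp, fun z hz => ?_⟩
    have h1 := (hd z hz).add ((Real.hasDerivAt_log hz.ne').const_mul (taylorCoeff φ 0))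
    simp only [pow_zero, div_one]
    refine h1.congr_deriv ?_
    rw [taylorCoeff_zero, h z hz.le]
    field_simp
    ring
  | succ N ih =>
    intro φ hφ
    obtain ⟨ψ, hψ, h⟩ := exists_contDiffOn_Ici_eq_add_mul hφ
    obtain ⟨W, hW, -, hd⟩ := ih hψ
    -- With `φ = φ(0) + zψ`, the constant integrates to a pure power, and `ψ / zᴺ⁺¹` is the
    -- inductive case, with the same logarithmic coefficient.
    refine ⟨fun z => -φ 0 / (N + 1 : ℕ) + z * W z, contDiffOn_const.add (contDiffOn_id.mul hW),
      by simp, fun z hz => ?_⟩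
    rw [taylorCoeff_succ_add_id_mul hψ h]
    have h1 := ((hasDerivAt_id z).pow (N + 1)).inv (pow_ne_zero _ hz.ne')
    have h2 := (h1.const_mul (-φ 0 / (N + 1 : ℕ))).add (hd z hz)
    refine (h2.congr_of_eventuallyEq ?_).congr_deriv ?_
    · filter_upwards [eventually_gt_nhds hz] with y hy
      simp
      field_simp
      ring
    · rw [h z hz.le]
      simp
      field_simp
      ring

/-! ### The radial variable -/

theorem radial_eq_norm_sq {n : ℕ} (x : Cn n) : radial x = ‖x‖ ^ 2 :=
  (EuclideanSpace.norm_sq_eq x).symm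

theorem radial_pos {n : ℕ} {x : Cn n} (hx : x ≠ 0) : 0 < radial x := by
  rw [radial_eq_norm_sq]
  positivity

theorem radial_real_smul {n : ℕ} (t : ℝ) (x : Cn n) : radial (t • x) = t ^ 2 * radial x := by
  rw [radial_eq_norm_sq, radial_eq_norm_sq, norm_smul, mul_pow, Real.norm_eq_abs, sq_abs]

theorem exists_radial_eq_one {n : ℕ} (hn : 2 ≤ n) : ∃ e : Cn n, radial e = 1 :=
  ⟨EuclideanSpace.single ⟨0, by omega⟩ 1, by simp [radial_eq_norm_sq]⟩

theorem contDiff_radial {n : ℕ} {m : WithTop ℕ∞} : ContDiff ℝ m (radial : Cn n → ℝ) := by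
  unfold radial
  refine ContDiff.sum fun i _ => ContDiff.norm_sq ℝ ?_
  exact ((EuclideanSpace.proj i : Cn n →L[ℂ] ℂ).restrictScalars ℝ).contDiff

/-- Euler's identity for a function homogeneous of degree 2. -/
theorem fderiv_radial_self {n : ℕ} (x : Cn n) : fderiv ℝ radial x x = 2 * radial x := by
  have h1 : HasFDerivAt (radial : Cn n → ℝ) (fderiv ℝ radial ((1 : ℝ) • x)) ((1 : ℝ) • x) :=
    ((contDiff_radial (m := 1)).differentiable (by simp) _).hasFDerivAt
  have h2 : HasDerivAt (fun t : ℝ => t • x) x 1 := by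
    simpa using (hasDerivAt_id (1 : ℝ)).smul_const x
  have h3 := h1.comp_hasDerivAt (1 : ℝ) h2
  change HasDerivAt (fun t : ℝ => radial (t • x)) (fderiv ℝ radial ((1 : ℝ) • x) x) 1 at h3
  rw [one_smul] at h3
  simp only [radial_real_smul] at h3
  refine h3.unique ?_
  simpa using ((hasDerivAt_id (1 : ℝ)).pow 2).mul_const (radial x)

theorem sqDiff_comp_radial {n : ℕ} {f : ℝ → ℝ} {f' : ℝ} {x : Cn n}
    (hf : HasDerivAt f f' (radial x)) (u v : Cn n) :
    sqDiff (fun y => f (radial y)) x u v = f' ^ 2 * sqDiff radial x u v := by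
  have h1 : HasFDerivAt (radial : Cn n → ℝ) (fderiv ℝ radial x) x :=
    ((contDiff_radial (m := 1)).differentiable (by simp) x).hasFDerivAt
  have h2 : fderiv ℝ (fun y => f (radial y)) x = f' • fderiv ℝ radial x :=
    (hf.comp_hasFDerivAt x h1).fderiv
  simp only [sqDiff, h2, smul_apply, smul_eq_mul]
  ring

theorem sqDiff_sqrt_radial {n : ℕ} {x : Cn n} (hx : x ≠ 0) (u v : Cn n) :
    sqDiff (fun y => √(radial y)) x u v = (4 * radial x)⁻¹ * sqDiff radial x u v := by
  have h := radial_pos hx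
  rw [sqDiff_comp_radial (Real.hasDerivAt_sqrt h.ne'), div_pow, mul_pow, Real.sq_sqrt h.le]
  norm_num [mul_comm]

/-- The radial vector lies in the kernel of both `h` and the Fubini-Study form, which isolates the
coefficient of `dr²`. -/
theorem hopf_self {n : ℕ} (x : Cn n) : hopf x x x = 0 := by
  have h := inner_self_im (𝕜 := ℂ) x
  rw [RCLike.im_eq_complex_im] at h
  simp only [hopf, h, zero_div, zero_mul]

theorem fubiniStudy_self {n : ℕ} (x : Cn n) : fubiniStudy x x x = 0 := by
  simp only [fubiniStudy]
  rw [inner_self_eq_norm_sq_to_K (𝕜 := ℂ) x]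
  simp

theorem contDiffOn_Ici_of_comp_radial {n : ℕ} (hn : 2 ≤ n) {F : ℝ → ℝ}
    (hF : ContDiff ℝ ∞ fun x : Cn n => F (radial x)) : ContDiffOn ℝ ∞ F (Ici 0) := by
  obtain ⟨e, he⟩ := exists_radial_eq_one hn
  refine contDiffOn_Ici_of_comp_sq ?_
  have h : ContDiff ℝ ∞ fun t : ℝ => t • e := contDiff_id.smul contDiff_const
  have := hF.comp h
  simpa only [Function.comp_def, radial_real_smul, he, mul_one] using this

/-! ### The inverse of the radial change of variable -/

/-- The solution `z ≥ 0` of `r² = β zᵏ⁺¹`. -/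
noncomputable def invRadius (k : ℕ) (β r : ℝ) : ℝ := (r ^ 2 / β) ^ ((k : ℝ) + 1)⁻¹

section InvRadius

variable {k : ℕ} {β : ℝ}

theorem invRadius_nonneg (hβ : 0 < β) (r : ℝ) : 0 ≤ invRadius k β r :=
  Real.rpow_nonneg (by positivity) _

theorem invRadius_pos (hβ : 0 < β) {r : ℝ} (hr : 0 < r) : 0 < invRadius k β r :=
  Real.rpow_pos_of_pos (by positivity) _

theorem invRadius_zero : invRadius k β 0 = 0 := by
  simp [invRadius, Real.zero_rpow (by positivity : ((k : ℝ) + 1)⁻¹ ≠ 0)]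

theorem invRadius_pow (hβ : 0 < β) (r : ℝ) : invRadius k β r ^ (k + 1) = r ^ 2 / β := by
  rw [invRadius]
  have := Real.rpow_inv_natCast_pow (x := r ^ 2 / β) (by positivity) (Nat.succ_ne_zero k)
  simpa using this

theorem invRadius_sqrt (hβ : 0 < β) {z : ℝ} (hz : 0 ≤ z) :
    invRadius k β √(β * z ^ (k + 1)) = z := by
  refine (pow_left_inj₀ (invRadius_nonneg hβ _) hz (Nat.succ_ne_zero k)).1 ?_
  rw [invRadius_pow hβ, Real.sq_sqrt (by positivity)]
  field_simp

theorem sqrt_invRadius (hβ : 0 < β) {r : ℝ} (hr : 0 ≤ r) :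
    √(β * invRadius k β r ^ (k + 1)) = r := by
  rw [invRadius_pow hβ, mul_div_cancel₀ _ hβ.ne', Real.sqrt_sq hr]

theorem continuous_invRadius : Continuous (invRadius k β) := by
  unfold invRadius
  exact Continuous.rpow_const (by fun_prop) fun _ => Or.inr (by positivity)

theorem invRadius_eq_mul_rpow (hβ : 0 < β) {r : ℝ} (hr : 0 ≤ r) :
    invRadius k β r = (β ^ ((k : ℝ) + 1)⁻¹)⁻¹ * r ^ (2 / ((k : ℝ) + 1)) := by
  rw [invRadius, Real.div_rpow (by positivity) hβ.le, ← Real.rpow_natCast r 2,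
    ← Real.rpow_mul hr, div_eq_inv_mul, div_eq_mul_inv (2 : ℝ)]
  norm_num

/-- The inverse is `r²/β` for `k = 0` and, on `r ≥ 0` only, `r/√β` for `k = 1`. -/
theorem contDiffOn_invRadius (hβ : 0 < β) (hk : k = 0 ∨ k = 1) {m : WithTop ℕ∞} :
    ContDiffOn ℝ m (invRadius k β) (Ici 0) := by
  rcases hk with rfl | rfl
  · have : invRadius 0 β = fun r => r ^ 2 / β := by
      funext r
      simp [invRadius]
    rw [this]
    exact ((contDiff_id.pow 2).div_const β).contDiffOn
  · refine ((contDiff_id.div_const (√β)).contDiffOn).congr fun r hr => ?_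
    rw [invRadius, show ((1 : ℕ) : ℝ) + 1 = 2 by norm_num, ← one_div, ← Real.sqrt_eq_rpow,
      Real.sqrt_div' _ hβ.le, Real.sqrt_sq hr, id]

/-- The exponent is a multiple of `k + 1`, so the power of `z` is `(r²/β)ⁿ⁻¹` whatever `k` is. -/
theorem invRadius_pow_mul_log (hβ : 0 < β) {n : ℕ} (hn : 2 ≤ n) {r : ℝ} (hr : 0 ≤ r) :
    invRadius k β r ^ ((k + 1) * (n - 1)) * Real.log (invRadius k β r) =
      r ^ (2 * n - 2) * (-(β⁻¹ ^ (n - 1) * Real.log β / (k + 1))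
        + 2 * β⁻¹ ^ (n - 1) / (k + 1) * Real.log r) := by
  rcases hr.eq_or_lt with rfl | hr
  · have h1 : (k + 1) * (n - 1) ≠ 0 := Nat.mul_ne_zero (by omega) (by omega)
    simp [invRadius_zero, show 2 * n - 2 ≠ 0 by omega]
  · have h2 : Real.log (invRadius k β r) = ((k : ℝ) + 1)⁻¹ * (2 * Real.log r - Real.log β) := by
      rw [invRadius, Real.log_rpow (by positivity), Real.log_div (by positivity) hβ.ne',
        Real.log_pow]
      norm_num
    rw [pow_mul, invRadius_pow hβ, h2, show 2 * n - 2 = 2 * (n - 1) by omega, pow_mul, div_pow,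
      inv_pow]
    field_simp
    ring

theorem tendsto_invRadius (hβ : 0 < β) : Tendsto (invRadius k β) (𝓝[>] 0) (𝓝[>] 0) := by
  refine tendsto_nhdsWithin_iff.2 ⟨?_, ?_⟩
  · have := (continuous_invRadius (k := k) (β := β)).tendsto 0
    rw [invRadius_zero] at this
    exact this.mono_left nhdsWithin_le_nhds
  · filter_upwards [self_mem_nhdsWithin] with r hr using invRadius_pos hβ hr

theorem isBigO_comp_invRadius (hβ : 0 < β) {f : ℝ → ℝ} (hf : f =O[𝓝[>] 0] fun z => z) :
    (fun r => f (invRadius k β r)) =O[𝓝[>] 0] fun r => r ^ (2 / ((k : ℝ) + 1)) := by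
  refine (hf.comp_tendsto (tendsto_invRadius hβ)).trans ?_
  have h : (fun r => (β ^ ((k : ℝ) + 1)⁻¹)⁻¹ * r ^ (2 / ((k : ℝ) + 1)))
      =O[𝓝[>] 0] fun r => r ^ (2 / ((k : ℝ) + 1)) :=
    (Asymptotics.isBigO_refl _ _).const_mul_left _
  refine h.congr' ?_ EventuallyEq.rfl
  filter_upwards [self_mem_nhdsWithin] with r hr
  exact (invRadius_eq_mul_rpow hβ (le_of_lt hr)).symm

theorem isBigO_sq_mul_comp_invRadius (hβ : 0 < β) {f : ℝ → ℝ} (c : ℝ)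
    (hf : f =O[𝓝[>] 0] fun z => z) :
    (fun r => c * r ^ 2 * f (invRadius k β r))
      =O[𝓝[>] 0] fun r => r ^ (2 * ((k : ℝ) + 2) / ((k : ℝ) + 1)) := by
  have h1 : (fun r : ℝ => c * r ^ 2) =O[𝓝[>] 0] fun r => r ^ 2 :=
    (Asymptotics.isBigO_refl _ _).const_mul_left _
  refine (h1.mul (isBigO_comp_invRadius hβ hf)).congr' EventuallyEq.rfl ?_
  filter_upwards [self_mem_nhdsWithin] with r hr
  rw [← Real.rpow_natCast r 2, ← Real.rpow_add hr]
  congr 1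
  field_simp
  norm_num
  ring

theorem isRadialChange_sqrt (hβ : 0 < β) :
    IsRadialChange fun z => √(β * z ^ (k + 1)) := by
  have hmono : StrictMonoOn (fun z : ℝ => √(β * z ^ (k + 1))) (Ici 0) := by
    intro x hx y hy hxy
    have hx' : (0 : ℝ) ≤ x := hx
    refine Real.sqrt_lt_sqrt (by positivity) ?_
    have := pow_lt_pow_left₀ hxy hx (Nat.succ_ne_zero k)
    gcongr
  have hpos : ∀ z : ℝ, 0 < z → 0 < β * z ^ (k + 1) := fun z hz => by positivity
  refine ⟨⟨fun z _ => Real.sqrt_nonneg _, hmono.injOn, fun r hr =>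
    ⟨invRadius k β r, invRadius_nonneg hβ r, sqrt_invRadius hβ hr⟩⟩, hmono,
    (by fun_prop : Continuous fun z => √(β * z ^ (k + 1))).continuousOn, ?_, fun z hz => ?_⟩
  · exact ContDiffOn.sqrt (by fun_prop) fun z hz => (hpos z hz).ne'
  · have h := ((((hasDerivAt_id z).pow (k + 1)).const_mul β).sqrt (hpos z hz).ne').deriv
    simp only [id] at h
    have h' : deriv (fun z => √(β * z ^ (k + 1))) z =
      β * ((k + 1 : ℕ) * z ^ (k + 1 - 1) * 1) / (2 * √(β * z ^ (k + 1))) := h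
    rw [h']
    have := Real.sqrt_pos.2 (hpos z hz)
    positivity

end InvRadius

/-! ### The functions `zᴺ log z` -/

theorem contDiff_pow_mul_log (m : ℕ) : ContDiff ℝ m fun x : ℝ => x ^ (m + 1) * Real.log x := by
  have hcont : ∀ m : ℕ, Continuous fun x : ℝ => x ^ (m + 1) * Real.log x := by
    intro m
    have := (continuous_pow (M := ℝ) m).mul Real.continuous_mul_log
    convert this using 2 with x
    simp only [Pi.mul_apply]
    ring
  induction m with
  | zero => exact contDiff_zero.2 (hcont 0)
  | succ m ih =>
    have hd : ∀ x : ℝ, HasDerivAt (fun x : ℝ => x ^ (m + 2) * Real.log x)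
        ((m + 2) * (x ^ (m + 1) * Real.log x) + x ^ (m + 1)) x := by
      have hne : ∀ x : ℝ, x ≠ 0 → HasDerivAt (fun x : ℝ => x ^ (m + 2) * Real.log x)
          ((m + 2) * (x ^ (m + 1) * Real.log x) + x ^ (m + 1)) x := by
        intro x hx
        refine ((hasDerivAt_pow (m + 2) x).mul (Real.hasDerivAt_log hx)).congr_deriv ?_
        push_cast
        field_simp
        ring
      intro x
      by_cases hx : x = 0
      · subst hx
        have hc := hcont m
        -- At `0` the derivative is obtained as the limit of the derivatives at nearby points.
        exact hasDerivAt_of_hasDerivAt_of_ne' (g := fun x : ℝ =>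
            (m + 2) * (x ^ (m + 1) * Real.log x) + x ^ (m + 1)) (x := 0) (fun y hy => hne y hy)
          (hcont (m + 1)).continuousAt (by fun_prop) 0
      · exact hne x hx
    push_cast
    rw [contDiff_succ_iff_deriv]
    refine ⟨fun x => (hd x).differentiableAt, by simp, ?_⟩
    rw [show deriv _ = _ from funext fun x => (hd x).deriv]
    exact (contDiff_const.mul ih).add (contDiff_id.pow (m + 1))

theorem contDiff_pow_mul_add_mul_log (m : ℕ) (p q : ℝ) :
    ContDiff ℝ m fun x : ℝ => x ^ (m + 1) * (p + q * Real.log x) := by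
  have h : ContDiff ℝ m fun x : ℝ => p * x ^ (m + 1) + q * (x ^ (m + 1) * Real.log x) :=
    (contDiff_const.mul (contDiff_id.pow (m + 1))).add
      (contDiff_const.mul (contDiff_pow_mul_log m))
  convert h using 2 with x
  ring

/-- Differentiation preserves the form of the function, lowers `m` and keeps `q` nonzero; for `m =
0` the logarithm is unbounded at `0`. -/
theorem not_contDiffOn_pow_mul_add_mul_log (m : ℕ) : ∀ {p q ε : ℝ} {f : ℝ → ℝ}, q ≠ 0 → 0 < ε →
    (∀ x ∈ Ioo 0 ε, f x = x ^ m * (p + q * Real.log x)) → ¬ ContDiffOn ℝ m f (Ico 0 ε) := by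
  induction m with
  | zero =>
    intro p q ε f hq hε hf h
    have h1 : Tendsto f (𝓝[>] 0) (𝓝 (f 0)) := by
      have := h.continuousOn 0 ⟨le_rfl, hε⟩
      refine this.tendsto.mono_left ?_
      rw [← nhdsWithin_Ioo_eq_nhdsGT hε]
      exact nhdsWithin_mono _ Ioo_subset_Ico_self
    have h2 : Tendsto Real.log (𝓝[>] 0) (𝓝 ((f 0 - p) / q)) := by
      refine ((h1.sub_const p).div_const q).congr' ?_
      filter_upwards [Ioo_mem_nhdsGT hε] with x hx
      rw [hf x hx]
      field_simp
      ring
    exact not_tendsto_nhds_of_tendsto_atBot Real.tendsto_log_nhdsGT_zero _ h2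
  | succ m ih =>
    intro p q ε f hq hε hf h
    have hu : UniqueDiffOn ℝ (Ico 0 ε) := uniqueDiffOn_Ico 0 ε
    push_cast at h
    refine ih (p := (m + 1) * p + q) (q := (m + 1) * q) (by positivity) hε ?_
      ((contDiffOn_succ_iff_derivWithin hu).1 h).2.2
    intro x hx
    have hx0 : x ≠ 0 := hx.1.ne'
    have h1 : HasDerivAt (fun x : ℝ => x ^ (m + 1) * (p + q * Real.log x))
        (x ^ m * ((m + 1) * p + q + (m + 1) * q * Real.log x)) x := by
      refine ((hasDerivAt_pow (m + 1) x).mul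
        (((Real.hasDerivAt_log hx0).const_mul q).const_add p)).congr_deriv ?_
      push_cast
      field_simp
      ring
    have h2 : HasDerivAt f (x ^ m * ((m + 1) * p + q + (m + 1) * q * Real.log x)) x := by
      refine h1.congr_of_eventuallyEq ?_
      filter_upwards [Ioo_mem_nhds hx.1 hx.2] with y hy using hf y hy
    exact h2.hasDerivWithinAt.derivWithin (hu x (Ioo_subset_Ico_self hx))

/-! ### The normal form of the metric at the origin -/

/-- `F = zᵏ G` and `P + (2n-1) C = (W + κ zᴺ log z) / zᴺ`, where `N = (k+1)(n-1)` and `G`, `W` are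
smooth up to the origin. -/
structure IsNormalForm (n k : ℕ) (F P : ℝ → ℝ) (C : ℝ) (G W : ℝ → ℝ) (κ : ℝ) : Prop where
  two_le : 2 ≤ n
  smooth_left : ContDiffOn ℝ ∞ G (Ici 0)
  smooth_right : ContDiffOn ℝ ∞ W (Ici 0)
  eq_pow_mul : ∀ z, 0 ≤ z → F z = z ^ k * G z
  pos : ∀ z, 0 ≤ z → 0 < G z
  taylor : taylorCoeff F k = G 0
  apply_zero : W 0 = -(G 0 ^ (n - 1))⁻¹ / ((k + 1) * (n - 1) : ℕ)
  antideriv : ∀ z, 0 < z → P z + (2 * (n : ℝ) - 1) * C =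
    (W z + κ * (z ^ ((k + 1) * (n - 1)) * Real.log z)) / z ^ ((k + 1) * (n - 1))

theorem exists_isNormalForm {n k : ℕ} (hn : 2 ≤ n) {F P : ℝ → ℝ} (C : ℝ)
    (hF : ContDiffOn ℝ ∞ F (Ici 0)) (hk : HasOrder F k) (hP : IsAntiderivative n F P)
    (hpos : ∀ z, 0 < z → 0 < F z) :
    ∃ G W : ℝ → ℝ, IsNormalForm n k F P C G W
      (obstruction n k F / (((k + 1) * (n - 1)).factorial : ℝ)) := by
  obtain ⟨G, hG, hFG, hT⟩ := hk.exists_eq_pow_mul hF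
  have hG0 : G 0 ≠ 0 := hT ▸ hk.2
  have hGpos' : ∀ z, 0 < z → 0 < G z := fun z hz => by
    have h := hpos z hz
    rw [hFG z hz.le] at h
    exact pos_of_mul_pos_right h (by positivity)
  have hGpos : ∀ z, 0 ≤ z → 0 < G z := by
    intro z hz
    rcases hz.eq_or_lt with rfl | hz
    -- A limit of positive values is nonnegative, and `G 0` is the nonzero leading coefficient.
    · refine lt_of_le_of_ne ?_ hG0.symm
      refine ge_of_tendsto ((hG.continuousOn 0 self_mem_Ici).mono Ioi_subset_Ici_self) ?_
      filter_upwards [self_mem_nhdsWithin] with z hz using (hGpos' z hz).le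
    · exact hGpos' z hz
  set N := (k + 1) * (n - 1) with hN
  have hN0 : N ≠ 0 := Nat.mul_ne_zero (by omega) (by omega)
  have hφ : ContDiffOn ℝ ∞ (fun z => (G z ^ (n - 1))⁻¹) (Ici 0) :=
    (hG.pow _).inv fun z hz => pow_ne_zero _ (hGpos z hz).ne'
  have hκ : taylorCoeff (fun z => (G z ^ (n - 1))⁻¹) N = obstruction n k F / (N.factorial : ℝ) := by
    rw [obstruction, ← hN, ← taylorCoeff]
    refine taylorCoeff_congr (fun z hz => ?_) N
    rcases (mem_Ici.1 hz).eq_or_lt with rfl | hz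
    · simp [quotPow, hT]
    · simp only [quotPow, hz.ne', if_false, hFG z hz.le]
      rw [div_mul_cancel_left₀ (by positivity), inv_pow]
  obtain ⟨W, hW, hW0, hd⟩ := exists_primitive_div_pow N hφ
  rw [hκ] at hd
  set κ := obstruction n k F / (N.factorial : ℝ)
  have hd' : ∀ z, 0 < z → HasDerivAt P ((G z ^ (n - 1))⁻¹ / z ^ (N + 1)) z := by
    intro z hz
    refine (hP z hz).congr_deriv ?_
    rw [hFG z hz.le, mul_pow, ← pow_mul, ← mul_assoc, ← pow_add]
    have : n + k * (n - 1) = N + 1 := by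
      obtain ⟨m, rfl⟩ := Nat.exists_eq_add_of_le hn
      rw [hN, show 2 + m - 1 = m + 1 by omega]
      ring
    rw [this]
    field_simp
  -- Primitives on the connected set `(0, ∞)` differ by a constant, read off at `z = 1`.
  have hQ : EqOn P (fun z => (W z / z ^ N + κ * Real.log z) +
      (P 1 - (W 1 / 1 ^ N + κ * Real.log 1))) (Ioi 0) := by
    refine isOpen_Ioi.eqOn_of_deriv_eq isPreconnected_Ioi
      (fun z hz => (hd' z hz).differentiableAt.differentiableWithinAt)
      (fun z hz => ((hd z hz).add_const _).differentiableAt.differentiableWithinAt)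
      (fun z hz => ?_) (mem_Ioi.2 one_pos) (by ring)
    rw [(hd' z hz).deriv, ((hd z hz).add_const _).deriv]
  -- All constants go into a multiple of `z ^ N`, which leaves `W 0` unchanged because `N ≠ 0`.
  refine ⟨G, fun z => W z + (P 1 - (W 1 / 1 ^ N + κ * Real.log 1) + (2 * (n : ℝ) - 1) * C) * z ^ N,
    hn, hG, hW.add (contDiffOn_const.mul (contDiffOn_id.pow N)), hFG, hGpos, hT, ?_, ?_⟩
  · rw [← hN, hW0 hN0]
    simp [hN0]
  · intro z hz
    rw [hQ hz]
    field_simp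
    ring

/-- The coefficient of `(d√z)² + z h`, divided by `zᵏ`. -/
noncomputable def profile (n k : ℕ) (G W : ℝ → ℝ) (κ z : ℝ) : ℝ :=
  ((k + 1) * G z + z * derivWithin G (Ici 0) z)
    - 2 / (G z ^ (n - 2) * (W z + κ * (z ^ ((k + 1) * (n - 1)) * Real.log z)))

namespace IsNormalForm

variable {n k : ℕ} {F P : ℝ → ℝ} {C : ℝ} {G W : ℝ → ℝ} {κ : ℝ}

theorem exponent_ne_zero (h : IsNormalForm n k F P C G W κ) : (k + 1) * (n - 1) ≠ 0 :=
  Nat.mul_ne_zero (by omega) (by have := h.two_le; omega)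

theorem two_mul_sub_one_pos (h : IsNormalForm n k F P C G W κ) : 0 < 2 * (n : ℝ) - 1 := by
  have : (2 : ℝ) ≤ n := by exact_mod_cast h.two_le
  linarith

theorem apply_zero_ne_zero (h : IsNormalForm n k F P C G W κ) : W 0 ≠ 0 := by
  rw [h.apply_zero]
  have h1 := h.pos 0 le_rfl
  have h2 := h.exponent_ne_zero
  have h3 : (0 : ℝ) < ((k + 1) * (n - 1) : ℕ) := by exact_mod_cast Nat.pos_of_ne_zero h2
  exact div_ne_zero (neg_ne_zero.2 (by positivity)) h3.ne'

/-- Since `2 / (G(0)ⁿ⁻² W(0)) = -2N G(0)`, the total is `((k+1) + 2(k+1)(n-1)) G(0)`. -/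
theorem profile_zero (h : IsNormalForm n k F P C G W κ) :
    profile n k G W κ 0 = (k + 1) * (2 * n - 1) * G 0 := by
  have h1 := h.pos 0 le_rfl
  have h2 := h.apply_zero
  have h3 := h.exponent_ne_zero
  obtain ⟨m, rfl⟩ := Nat.exists_eq_add_of_le h.two_le
  simp only [profile, zero_pow h3, h2]
  rw [show 2 + m - 1 = m + 1 by omega, show 2 + m - 2 = m by omega]
  push_cast
  field_simp
  ring

/-- In the second term the powers of `z` combine to `zᵏ`, as `N - (n-1) - k(n-2) = k`. -/
theorem coeff_eq (h : IsNormalForm n k F P C G W κ) {z : ℝ} (hz : 0 < z) :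
    coeff n F P C z = z ^ k * profile n k G W κ z := by
  have h1 : deriv (fun t => t * F t) z =
      z ^ k * ((k + 1) * G z + z * derivWithin G (Ici 0) z) := by
    have hd := (hasDerivAt_pow (k + 1) z).mul (contDiffOn_Ici_hasDerivAt h.smooth_left hz)
    have he : (fun t => t * F t) =ᶠ[𝓝 z] fun t => t ^ (k + 1) * G t := by
      filter_upwards [eventually_gt_nhds hz] with t ht
      rw [h.eq_pow_mul t ht.le]
      ring
    rw [he.deriv_eq]
    refine hd.deriv.trans ?_
    rw [Nat.add_sub_cancel]
    push_cast
    ring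
  rw [coeff, h1, h.antideriv z hz, profile, mul_sub, h.eq_pow_mul z hz.le]
  congr 1
  set V := W z + κ * (z ^ ((k + 1) * (n - 1)) * Real.log z)
  obtain ⟨m, rfl⟩ := Nat.exists_eq_add_of_le h.two_le
  rw [show 2 + m - 1 = m + 1 by omega, show 2 + m - 2 = m by omega, inv_div, mul_pow, ← pow_mul,
    show (k + 1) * (m + 1) = m + 1 + k * m + k by ring, pow_add _ _ k]
  field_simp
  rw [pow_add]

/-- Only the log term needs a regularity hypothesis, and `W 0 ≠ 0` keeps the denominator away from
zero near the origin. A general `ζ` serves both the variable `z` itself and the substitution `z =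
z(r)`. -/
theorem ofClassAtZero_profile_comp (h : IsNormalForm n k F P C G W κ) {ℓ : ℕ∞} {ζ : ℝ → ℝ}
    (hζ : ContDiffOn ℝ ℓ ζ (Ici 0)) (h0 : ζ 0 = 0) (hmap : MapsTo ζ (Ici 0) (Ici 0))
    (hlog : ContDiffOn ℝ ℓ (fun r => κ * (ζ r ^ ((k + 1) * (n - 1)) * Real.log (ζ r))) (Ici 0)) :
    OfClassAtZero ℓ fun r => profile n k G W κ (ζ r) := by
  have hle : (ℓ : WithTop ℕ∞) ≤ ∞ := by exact_mod_cast le_top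
  have hG := (h.smooth_left.of_le hle).comp hζ hmap
  have hG' := ((contDiffOn_Ici_derivWithin h.smooth_left).of_le hle).comp hζ hmap
  have hV := ((h.smooth_right.of_le hle).comp hζ hmap).add hlog
  have hV0 : ∀ᶠ r in 𝓝[Ici 0] (0 : ℝ),
      W (ζ r) + κ * (ζ r ^ ((k + 1) * (n - 1)) * Real.log (ζ r)) ≠ 0 := by
    refine (hV.continuousOn 0 self_mem_Ici).eventually_ne ?_
    simpa [h0, h.exponent_ne_zero] using h.apply_zero_ne_zero
  obtain ⟨ε, hε, hne⟩ := mem_nhdsGE_iff_exists_Ico_subset.1 hV0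
  have hsub : Ico 0 ε ⊆ Ici 0 := Ico_subset_Ici_self
  refine ⟨ε, hε, ?_⟩
  refine ContDiffOn.sub ((contDiffOn_const.mul hG).add (hζ.mul hG') |>.mono hsub) ?_
  refine contDiffOn_const.div (((hG.pow _).mono hsub).mul (hV.mono hsub)) fun r hr => ?_
  exact mul_ne_zero (pow_ne_zero _ (h.pos _ (hmap (hsub hr))).ne') (hne hr)

theorem tendsto_profile (h : IsNormalForm n k F P C G W κ) :
    Tendsto (profile n k G W κ) (𝓝[>] 0) (𝓝 (profile n k G W κ 0)) := by
  obtain ⟨m, hm⟩ := Nat.exists_eq_succ_of_ne_zero h.exponent_ne_zero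
  obtain ⟨ε, hε, hc⟩ := h.ofClassAtZero_profile_comp (ℓ := 0) (ζ := id) contDiffOn_id rfl
    (mapsTo_id _) (by
      rw [hm]
      exact (contDiff_const.mul
        ((contDiff_pow_mul_log m).of_le (by exact_mod_cast Nat.zero_le m))).contDiffOn)
  refine (hc.continuousOn 0 ⟨le_rfl, hε⟩).tendsto.mono_left ?_
  rw [← nhdsWithin_Ioo_eq_nhdsGT hε]
  exact nhdsWithin_mono _ Ioo_subset_Ico_self

/-- The exclusion of `(2, 0)` means exactly `N ≥ 2`, when `zᴺ log z` is `C¹`; for `N = 1` the term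
`z log z` is not `O(z)`. -/
theorem isBigO_profile (h : IsNormalForm n k F P C G W κ) (hnk : ¬ (n = 2 ∧ k = 0)) :
    (fun z => profile n k G W κ z - profile n k G W κ 0) =O[𝓝[>] 0] fun z => z := by
  obtain ⟨m, hm⟩ : ∃ m, (k + 1) * (n - 1) = m + 1 + 1 := by
    have h1 := h.two_le
    refine ⟨(k + 1) * (n - 1) - 2, ?_⟩
    have : 2 ≤ (k + 1) * (n - 1) := by
      rcases Nat.eq_zero_or_pos k with rfl | hk
      · omega
      · nlinarith [show 1 ≤ n - 1 by omega]
    omega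
  obtain ⟨ε, hε, hc⟩ := h.ofClassAtZero_profile_comp (ℓ := 1) (ζ := id) contDiffOn_id rfl
    (mapsTo_id _) (by
      rw [hm]
      exact (contDiff_const.mul ((contDiff_pow_mul_log (m + 1)).of_le
        (by exact_mod_cast Nat.le_add_left 1 m))).contDiffOn)
  have hd := (hc.differentiableOn (by simp) 0 ⟨le_rfl, hε⟩).isBigO_sub
  simp only [id, sub_zero] at hd
  refine hd.mono ?_
  rw [← nhdsWithin_Ioo_eq_nhdsGT hε]
  exact nhdsWithin_mono _ Ioo_subset_Ico_self

theorem isBigO_left (h : IsNormalForm n k F P C G W κ) :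
    (fun z => G z - G 0) =O[𝓝[>] 0] fun z => z := by
  have hd := (h.smooth_left.differentiableOn (by simp) 0 self_mem_Ici).isBigO_sub
  simp only [sub_zero] at hd
  exact hd.mono (nhdsWithin_mono _ Ioi_subset_Ici_self)

end IsNormalForm

/-! ### The expansion over the cone -/

/-- The constant `β` in `r² = β zᵏ⁺¹`. -/
noncomputable def coneConst (n k : ℕ) (G : ℝ → ℝ) : ℝ :=
  (2 * (n : ℝ) - 1) / ((k : ℝ) + 1) * G 0

/-- The relative radial remainder, as a function of `r`. -/
noncomputable def radialRemainder (n k : ℕ) (G W : ℝ → ℝ) (κ r : ℝ) : ℝ :=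
  ((k + 1) * (2 * n - 1) * G 0)⁻¹ *
    (profile n k G W κ (invRadius k (coneConst n k G) r) - profile n k G W κ 0)

/-- The remainder in the direction of the projective space, as a function of `r`. -/
noncomputable def projectiveRemainder (n k : ℕ) (G : ℝ → ℝ) (r : ℝ) : ℝ :=
  (coneConst n k G)⁻¹ * r ^ 2 * (G (invRadius k (coneConst n k G) r) - G 0)

/-- Evaluating both expansions on the radial vector kills `h` and the Fubini-Study form, while `dr`
does not vanish there. -/
theorem IsConeExpansion.radial_unique {n k : ℕ} (hn : 2 ≤ n) {g : Cn n → Cn n → Cn n → ℝ}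
    {r a b c a' b' c' : ℝ → ℝ} (hr : IsRadialChange r) (h : IsConeExpansion n k g r a b c)
    (h' : IsConeExpansion n k g r a' b' c') {s : ℝ} (hs : 0 < s) : a s = a' s := by
  obtain ⟨hbij, hmono, -, -, hderiv⟩ := hr
  obtain ⟨z, hz, rfl⟩ := hbij.surjOn hs.le
  have hz' : 0 < z := by
    refine lt_of_le_of_ne hz ?_
    rintro rfl
    obtain ⟨w, hw, hw'⟩ := hbij.surjOn (self_mem_Ici (a := (0 : ℝ)))
    have := hmono.monotoneOn self_mem_Ici hw hw
    linarith
  obtain ⟨e, he⟩ := exists_radial_eq_one hn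
  set x : Cn n := √z • e with hx
  have hrad : radial x = z := by rw [hx, radial_real_smul, he, Real.sq_sqrt hz, mul_one]
  have hx0 : x ≠ 0 := by
    intro h0
    rw [h0, radial_eq_norm_sq] at hrad
    simp at hrad
    exact hz'.ne hrad
  have hd := hderiv z hz'
  have hsq : sqDiff (fun y : Cn n => r (radial y)) x x x ≠ 0 := by
    rw [sqDiff_comp_radial (f' := deriv r z)
      (by rw [hrad]; exact (differentiableAt_of_deriv_ne_zero hd.ne').hasDerivAt)]
    simp only [sqDiff, fderiv_radial_self, hrad]
    positivity
  have h1 := h x hx0 x x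
  rw [h' x hx0 x x, hopf_self, fubiniStudy_self, hrad] at h1
  simp only [mul_zero, add_zero, add_right_inj] at h1
  exact (mul_right_cancel₀ hsq h1).symm

namespace IsNormalForm

variable {n k : ℕ} {F P : ℝ → ℝ} {C : ℝ} {G W : ℝ → ℝ} {κ : ℝ}

theorem coneConst_pos (h : IsNormalForm n k F P C G W κ) : 0 < coneConst n k G := by
  have h1 := h.pos 0 le_rfl
  have h2 := h.two_mul_sub_one_pos
  unfold coneConst
  positivity

theorem coneRadius_eq (h : IsNormalForm n k F P C G W κ) :
    coneRadius n k F = fun z => √(coneConst n k G * z ^ (k + 1)) := by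
  funext z
  rw [coneRadius, h.taylor, coneConst]

theorem isRadialChange (h : IsNormalForm n k F P C G W κ) :
    IsRadialChange (coneRadius n k F) := by
  rw [h.coneRadius_eq]
  exact isRadialChange_sqrt h.coneConst_pos

/-- The forms `(d√z)²` and `z h` share the coefficient `zᵏ E`, so `b` is `a` times `r² E(0)/β =
(k+1)² r²`. -/
theorem isConeExpansion (h : IsNormalForm n k F P C G W κ) :
    IsConeExpansion n k (metric n F P C) (coneRadius n k F) (radialRemainder n k G W κ)
      (fun r => ((k : ℝ) + 1) ^ 2 * r ^ 2 * radialRemainder n k G W κ r)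
      (projectiveRemainder n k G) := by
  intro x hx u v
  have hz := radial_pos hx
  have hβ := h.coneConst_pos
  have h1 := h.pos 0 le_rfl
  have h2 := h.two_mul_sub_one_pos
  rw [h.coneRadius_eq, metric, h.coeff_eq hz, sqDiff_sqrt_radial hx]
  have hpos : 0 < coneConst n k G * radial x ^ (k + 1) := by positivity
  have hd : HasDerivAt (fun z => √(coneConst n k G * z ^ (k + 1)))
      (coneConst n k G * ((k + 1 : ℕ) * radial x ^ k) /
        (2 * √(coneConst n k G * radial x ^ (k + 1)))) (radial x) :=
    ((hasDerivAt_pow (k + 1) (radial x)).const_mul (coneConst n k G)).sqrt hpos.ne'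
  rw [sqDiff_comp_radial hd, div_pow, mul_pow 2]
  simp only [radialRemainder, projectiveRemainder]
  rw [invRadius_sqrt hβ hz.le, Real.sq_sqrt hpos.le, h.eq_pow_mul _ hz.le, h.profile_zero]
  push_cast
  generalize profile n k G W κ (radial x) = E
  generalize G (radial x) = g
  generalize radial x = z at *
  unfold coneConst
  field_simp
  ring

/-! ### Regularity classes of the extension over the origin -/

theorem hasClass (h : IsNormalForm n k F P C G W κ) {ℓ : ℕ∞}
    (hζ : ContDiffOn ℝ ℓ (invRadius k (coneConst n k G)) (Ici 0))
    (hlog : ContDiffOn ℝ ℓ (fun r => κ * (invRadius k (coneConst n k G) r ^ ((k + 1) * (n - 1)) *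
      Real.log (invRadius k (coneConst n k G) r))) (Ici 0)) :
    HasClass n k (metric n F P C) (coneRadius n k F) ℓ := by
  have hmap : MapsTo (invRadius k (coneConst n k G)) (Ici 0) (Ici 0) :=
    fun r _ => invRadius_nonneg h.coneConst_pos r
  obtain ⟨ε, hε, hE⟩ := h.ofClassAtZero_profile_comp hζ invRadius_zero hmap hlog
  have ha : ContDiffOn ℝ ℓ (radialRemainder n k G W κ) (Ico 0 ε) :=
    contDiffOn_const.mul (hE.sub contDiffOn_const)
  refine ⟨_, _, _, h.isConeExpansion, ⟨ε, hε, ha⟩,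
    ⟨ε, hε, (contDiffOn_const.mul (contDiffOn_id.pow 2)).mul ha⟩, 1, one_pos, ?_⟩
  have hG := (h.smooth_left.of_le (by exact_mod_cast le_top)).comp hζ hmap
  exact ((contDiffOn_const.mul (contDiffOn_id.pow 2)).mul (hG.sub contDiffOn_const)).mono
    Ico_subset_Ici_self

theorem hasClass_zero (h : IsNormalForm n k F P C G W κ) :
    HasClass n k (metric n F P C) (coneRadius n k F) 0 := by
  obtain ⟨m, hm⟩ := Nat.exists_eq_succ_of_ne_zero h.exponent_ne_zero
  refine h.hasClass (contDiffOn_zero.2 continuous_invRadius.continuousOn) ?_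
  rw [hm]
  exact contDiffOn_zero.2 ((continuous_const.mul
    ((contDiff_pow_mul_log m).continuous.comp continuous_invRadius)).continuousOn)

theorem hasClass_top (h : IsNormalForm n k F P C G W 0) (hk : k = 0 ∨ k = 1) :
    HasClass n k (metric n F P C) (coneRadius n k F) ⊤ :=
  h.hasClass (contDiffOn_invRadius h.coneConst_pos hk) (by simpa using contDiffOn_const)

theorem hasClass_of_le_one (h : IsNormalForm n k F P C G W κ) (hk : k = 0 ∨ k = 1) :
    HasClass n k (metric n F P C) (coneRadius n k F) ((2 * n - 3 : ℕ) : ℕ∞) := by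
  refine h.hasClass (contDiffOn_invRadius h.coneConst_pos hk) ?_
  have h1 := (contDiff_const (c := κ)).mul (contDiff_pow_mul_add_mul_log (2 * n - 3)
    (-((coneConst n k G)⁻¹ ^ (n - 1) * Real.log (coneConst n k G) / (k + 1)))
    (2 * (coneConst n k G)⁻¹ ^ (n - 1) / (k + 1)))
  refine h1.contDiffOn.congr fun r hr => ?_
  rw [invRadius_pow_mul_log h.coneConst_pos h.two_le hr,
    show 2 * n - 3 + 1 = 2 * n - 2 by have := h.two_le; omega]

theorem isLittleO_radialRemainder (h : IsNormalForm n k F P C G W κ) :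
    radialRemainder n k G W κ =o[𝓝[>] 0] fun _ => (1 : ℝ) := by
  rw [Asymptotics.isLittleO_one_iff]
  have := ((h.tendsto_profile.comp (tendsto_invRadius (k := k) h.coneConst_pos)).sub_const
    (profile n k G W κ 0)).const_mul ((k + 1) * (2 * n - 1) * G 0)⁻¹
  rw [sub_self, mul_zero] at this
  exact this

/-- The formula for `E` can be solved for `κ zᴺ log z` in terms of `a` and functions smooth in `r`.
A `C²ⁿ⁻²` choice of `a` would make `r²ⁿ⁻²(p + q log r)` of that class too. -/
theorem not_hasClass (h : IsNormalForm n k F P C G W κ) (hk : k = 0 ∨ k = 1) (hκ : κ ≠ 0) :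
    ¬ HasClass n k (metric n F P C) (coneRadius n k F) ((2 * n - 2 : ℕ) : ℕ∞) := by
  rintro ⟨a, b, c, hexp, ⟨ε, hε, ha⟩, -, -⟩
  have hβ := h.coneConst_pos
  have hG0 := h.pos 0 le_rfl
  have h2 := h.two_mul_sub_one_pos
  set β := coneConst n k G
  have hK : (k + 1) * (2 * n - 1) * G 0 ≠ 0 := by positivity
  have haE : ∀ r, 0 < r → profile n k G W κ (invRadius k β r) =
      (k + 1) * (2 * n - 1) * G 0 * (a r + 1) := by
    intro r hr
    rw [hexp.radial_unique h.two_le h.isRadialChange h.isConeExpansion hr, radialRemainder,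
      h.profile_zero]
    field_simp
    ring
  have hle : (((2 * n - 2 : ℕ) : ℕ∞) : WithTop ℕ∞) ≤ ∞ := by exact_mod_cast le_top
  have hζ : ContDiffOn ℝ ((2 * n - 2 : ℕ) : ℕ∞) (invRadius k β) (Ici 0) :=
    contDiffOn_invRadius hβ hk
  have hmap : MapsTo (invRadius k β) (Ici 0) (Ici 0) := fun r _ => invRadius_nonneg hβ r
  have hG := (h.smooth_left.of_le hle).comp hζ hmap
  have hG' := ((contDiffOn_Ici_derivWithin h.smooth_left).of_le hle).comp hζ hmap
  have hW := (h.smooth_right.of_le hle).comp hζ hmap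
  have hsub : Ico 0 ε ⊆ Ici 0 := Ico_subset_Ici_self
  set A : ℝ → ℝ := fun r => (k + 1) * G (invRadius k β r) +
    invRadius k β r * derivWithin G (Ici 0) (invRadius k β r) with hA
  set V : ℝ → ℝ := fun r => W (invRadius k β r) +
    κ * (invRadius k β r ^ ((k + 1) * (n - 1)) * Real.log (invRadius k β r)) with hV
  set D : ℝ → ℝ := fun r => A r - (k + 1) * (2 * n - 1) * G 0 * (a r + 1) with hD
  have hAc : ContDiffOn ℝ ((2 * n - 2 : ℕ) : ℕ∞) A (Ici 0) :=
    (contDiffOn_const.mul hG).add (hζ.mul hG')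
  have hDc : ContDiffOn ℝ ((2 * n - 2 : ℕ) : ℕ∞) D (Ico 0 ε) :=
    (hAc.mono hsub).sub (contDiffOn_const.mul (ha.add contDiffOn_const))
  have hDV : ∀ r, 0 < r → D r = 2 / (G (invRadius k β r) ^ (n - 2) * V r) := by
    intro r hr
    rw [hD]
    simp only
    rw [← haE r hr, profile]
    ring
  -- The value `a 0` is not prescribed, so `D 0` is computed as a limit from the right.
  have hD0 : D 0 ≠ 0 := by
    have hle' : 𝓝[>] (0 : ℝ) ≤ 𝓝[Ico 0 ε] 0 := by
      rw [← nhdsWithin_Ioo_eq_nhdsGT hε]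
      exact nhdsWithin_mono _ Ioo_subset_Ico_self
    have t1 : Tendsto D (𝓝[>] 0) (𝓝 (D 0)) :=
      (hDc.continuousOn 0 ⟨le_rfl, hε⟩).tendsto.mono_left hle'
    have t2 : Tendsto A (𝓝[>] 0) (𝓝 (A 0)) :=
      (hAc.continuousOn 0 self_mem_Ici).tendsto.mono_left
        (nhdsWithin_mono _ Ioi_subset_Ici_self)
    have t3 := t2.sub (h.tendsto_profile.comp (tendsto_invRadius (k := k) hβ))
    have t4 : Tendsto D (𝓝[>] 0) (𝓝 (A 0 - profile n k G W κ 0)) := by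
      refine t3.congr' ?_
      filter_upwards [self_mem_nhdsWithin] with r hr
      simp [hD, haE r hr]
    rw [tendsto_nhds_unique t1 t4, hA, profile]
    simp only [invRadius_zero, sub_sub_cancel, zero_pow h.exponent_ne_zero, zero_mul, mul_zero,
      add_zero]
    exact div_ne_zero two_ne_zero (mul_ne_zero (pow_ne_zero _ hG0.ne') h.apply_zero_ne_zero)
  obtain ⟨δ, hδ, hne⟩ : ∃ δ > 0, Ico 0 δ ⊆ {r | D r ≠ 0} := by
    have := (hDc.continuousOn 0 ⟨le_rfl, hε⟩).eventually_ne hD0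
    rw [nhdsWithin_Ico_eq_nhdsGE hε] at this
    exact mem_nhdsGE_iff_exists_Ico_subset.1 this
  set η := min ε δ
  have hη : 0 < η := lt_min hε hδ
  have hηε : Ico 0 η ⊆ Ico 0 ε := Ico_subset_Ico_right (min_le_left _ _)
  have hηδ : Ico 0 η ⊆ Ico 0 δ := Ico_subset_Ico_right (min_le_right _ _)
  -- For `r > 0` this function is the isolated log term.
  have hT : ContDiffOn ℝ ((2 * n - 2 : ℕ) : ℕ∞)
      (fun r => 2 / (D r * G (invRadius k β r) ^ (n - 2)) - W (invRadius k β r)) (Ico 0 η) := by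
    refine ContDiffOn.sub (contDiffOn_const.div ((hDc.mono hηε).mul
      ((hG.pow _).mono (hηε.trans hsub))) fun r hr => ?_) (hW.mono (hηε.trans hsub))
    exact mul_ne_zero (hne (hηδ hr)) (pow_ne_zero _ (h.pos _ (invRadius_nonneg hβ r)).ne')
  refine not_contDiffOn_pow_mul_add_mul_log (2 * n - 2)
    (p := κ * -(β⁻¹ ^ (n - 1) * Real.log β / (k + 1)))
    (q := κ * (2 * β⁻¹ ^ (n - 1) / (k + 1))) (mul_ne_zero hκ (by positivity)) hη ?_
    (by exact_mod_cast hT)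
  intro r hr
  have hDr : D r ≠ 0 := hne (hηδ (Ioo_subset_Ico_self hr))
  have hGr := h.pos _ (invRadius_nonneg (k := k) hβ r)
  have hVr : V r ≠ 0 := by
    intro hVr
    rw [hDV r hr.1, hVr] at hDr
    simp at hDr
  have hVeq : 2 / (D r * G (invRadius k β r) ^ (n - 2)) = V r := by
    rw [hDV r hr.1]
    field_simp
  rw [hVeq]
  simp only [hV]
  rw [invRadius_pow_mul_log hβ h.two_le hr.1.le]
  ring

/-- A `C¹` remainder would be `O(r)`, but `d ≠ 0` bounds `z` by a multiple of `a`. Hence `z = O(r)`,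
and the `(k+1)`-st power gives `r² = O(rᵏ⁺¹)`, absurd for `k ≥ 2`. -/
theorem not_hasClass_one (h : IsNormalForm n k F P C G W κ) (hk : 2 ≤ k) {d : ℝ}
    (hd : HasDerivWithinAt (profile n k G W κ) d (Ioi 0) 0) (hd0 : d ≠ 0) :
    ¬ HasClass n k (metric n F P C) (coneRadius n k F) 1 := by
  rintro ⟨a, b, c, hexp, ⟨ε, hε, ha⟩, -, -⟩
  have hβ := h.coneConst_pos
  have hG0 := h.pos 0 le_rfl
  have h2 := h.two_mul_sub_one_pos
  have hle : 𝓝[>] (0 : ℝ) ≤ 𝓝[Ico 0 ε] 0 := by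
    rw [← nhdsWithin_Ioo_eq_nhdsGT hε]
    exact nhdsWithin_mono _ Ioo_subset_Ico_self
  have haE : ∀ r, 0 < r → a r = radialRemainder n k G W κ r := fun r hr =>
    hexp.radial_unique h.two_le h.isRadialChange h.isConeExpansion hr
  have ha0 : a 0 = 0 := by
    have t1 : Tendsto a (𝓝[>] 0) (𝓝 (a 0)) :=
      (ha.continuousOn 0 ⟨le_rfl, hε⟩).tendsto.mono_left hle
    refine tendsto_nhds_unique t1 ?_
    refine ((Asymptotics.isLittleO_one_iff ℝ).1 h.isLittleO_radialRemainder).congr' ?_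
    filter_upwards [self_mem_nhdsWithin] with r hr using (haE r hr).symm
  have hbig : a =O[𝓝[>] 0] fun r => r := by
    have := (ha.differentiableOn (by simp) 0 ⟨le_rfl, hε⟩).isBigO_sub.mono hle
    simpa [ha0] using this
  have hζ : (invRadius k (coneConst n k G)) =O[𝓝[>] 0] a := by
    have h1 : (fun z => z) =O[𝓝[>] 0]
        fun z => profile n k G W κ z - profile n k G W κ 0 := by
      have := (hd.isTheta_sub hd0).isBigO_symm
      simpa [Function.comp_def] using this
    refine ((h1.comp_tendsto (tendsto_invRadius hβ)).trans ?_)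
    have hK : ((k + 1) * (2 * n - 1) * G 0)⁻¹ ≠ 0 := by positivity
    refine ((Asymptotics.isBigO_refl _ _).const_mul_right hK).congr' EventuallyEq.rfl ?_
    filter_upwards [self_mem_nhdsWithin] with r hr
    rw [haE r hr]
    rfl
  have h3 : (fun r : ℝ => r ^ 2) =O[𝓝[>] 0] fun r => r ^ (k + 1) := by
    refine (((hζ.trans hbig).pow (k + 1)).const_mul_left (coneConst n k G)).congr_left fun r => ?_
    rw [invRadius_pow hβ, mul_div_cancel₀ _ hβ.ne']
  have h4 : (fun r : ℝ => r ^ (k + 1)) =o[𝓝[>] 0] fun r => r ^ 2 :=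
    (Asymptotics.isLittleO_pow_pow (by omega)).mono nhdsWithin_le_nhds
  refine Asymptotics.isLittleO_irrefl ?_ (h3.trans_isLittleO h4)
  refine Eventually.frequently ?_
  filter_upwards [self_mem_nhdsWithin] with r hr using pow_ne_zero 2 (ne_of_gt hr)

end IsNormalForm

theorem isLittleO_const_mul_sq_mul {f : ℝ → ℝ} (c : ℝ) (hf : Tendsto f (𝓝[>] 0) (𝓝 0)) :
    (fun r => c * r ^ 2 * f r) =o[𝓝[>] 0] fun r => r ^ 2 := by
  have h1 : (fun r : ℝ => c * r ^ 2) =O[𝓝[>] 0] fun r => r ^ 2 :=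
    (Asymptotics.isBigO_refl _ _).const_mul_left _
  simpa using h1.mul_isLittleO ((Asymptotics.isLittleO_one_iff ℝ).2 hf)

namespace IsNormalForm

variable {n k : ℕ} {F P : ℝ → ℝ} {C : ℝ} {G W : ℝ → ℝ} {κ : ℝ}

theorem isLittleO_projectiveRemainder (h : IsNormalForm n k F P C G W κ) :
    projectiveRemainder n k G =o[𝓝[>] 0] fun r => r ^ 2 := by
  refine isLittleO_const_mul_sq_mul _ ?_
  have h1 := h.isBigO_left.trans_tendsto
    ((continuous_id.tendsto (0 : ℝ)).mono_left nhdsWithin_le_nhds)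
  exact h1.comp (tendsto_invRadius h.coneConst_pos)

theorem isBigO_projectiveRemainder (h : IsNormalForm n k F P C G W κ) :
    projectiveRemainder n k G =O[𝓝[>] 0] fun r => r ^ (2 * ((k : ℝ) + 2) / ((k : ℝ) + 1)) :=
  isBigO_sq_mul_comp_invRadius h.coneConst_pos _ h.isBigO_left

theorem isBigO_radialRemainder (h : IsNormalForm n k F P C G W κ) (hnk : ¬ (n = 2 ∧ k = 0)) :
    radialRemainder n k G W κ =O[𝓝[>] 0] fun r => r ^ (2 / ((k : ℝ) + 1)) :=
  isBigO_comp_invRadius h.coneConst_pos ((h.isBigO_profile hnk).const_mul_left _)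

theorem isBigO_hopfRemainder (h : IsNormalForm n k F P C G W κ) (hnk : ¬ (n = 2 ∧ k = 0)) :
    (fun r => ((k : ℝ) + 1) ^ 2 * r ^ 2 * radialRemainder n k G W κ r)
      =O[𝓝[>] 0] fun r => r ^ (2 * ((k : ℝ) + 2) / ((k : ℝ) + 1)) :=
  isBigO_sq_mul_comp_invRadius h.coneConst_pos _ ((h.isBigO_profile hnk).const_mul_left _)

end IsNormalForm

/-! ### A pair whose metric is not of class `C¹` over the origin when `k ≥ 2` -/

/-- The function `(1 + z) ^ (-1 / (n-1))`. -/
noncomputable def exampleG (n : ℕ) (z : ℝ) : ℝ := (1 + z) ^ (-((n : ℝ) - 1)⁻¹)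

/-- The function `F = zᵏ (1 + z) ^ (-1 / (n-1))`. -/
noncomputable def exampleF (n k : ℕ) (z : ℝ) : ℝ := z ^ k * exampleG n z

/-- The numerator of the primitive of `(1 + z) / zᴺ⁺¹`. -/
noncomputable def exampleW (N : ℕ) (z : ℝ) : ℝ := -(1 / (N : ℝ) + z / ((N : ℝ) - 1))

/-- The primitive of `(1 + z) / zᴺ⁺¹` vanishing at infinity. -/
noncomputable def exampleP (N : ℕ) (z : ℝ) : ℝ := exampleW N z / z ^ N

theorem exampleG_pos (n : ℕ) {z : ℝ} (hz : 0 ≤ z) : 0 < exampleG n z :=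
  Real.rpow_pos_of_pos (by positivity) _

theorem exampleG_zero (n : ℕ) : exampleG n 0 = 1 := by simp [exampleG]

/-- The exponent in `exampleG` is chosen for this: the integrand becomes `(1 + z) / zᴺ⁺¹`, whose
primitive has no logarithm when `N ≥ 2`. -/
theorem exampleG_pow {n : ℕ} (hn : 2 ≤ n) {z : ℝ} (hz : 0 ≤ z) :
    exampleG n z ^ (n - 1) = (1 + z)⁻¹ := by
  have h1 : ((n - 1 : ℕ) : ℝ) = (n : ℝ) - 1 := by
    rw [Nat.cast_sub (by omega)]
    simp
  have h2 : (n : ℝ) - 1 ≠ 0 := by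
    have : (2 : ℝ) ≤ n := by exact_mod_cast hn
    linarith
  rw [exampleG, ← Real.rpow_natCast, ← Real.rpow_mul (by positivity), h1, neg_mul,
    inv_mul_cancel₀ h2, Real.rpow_neg_one]

theorem contDiffOn_exampleG (n : ℕ) : ContDiffOn ℝ ∞ (exampleG n) (Ici 0) := by
  refine ContDiffOn.rpow_const_of_ne (by fun_prop) fun z hz => ?_
  have : (0 : ℝ) ≤ z := hz
  positivity

theorem contDiff_exampleF (n k : ℕ) : ContDiff ℝ ∞ fun x : Cn n => exampleF n k (radial x) := by
  have hr : ContDiff ℝ ∞ (radial : Cn n → ℝ) := contDiff_radial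
  refine (hr.pow k).mul ((contDiff_const.add hr).rpow_const_of_ne fun x => ?_)
  rw [radial_eq_norm_sq]
  positivity

theorem hasDerivAt_exampleP {N : ℕ} (hN : 2 ≤ N) {z : ℝ} (hz : 0 < z) :
    HasDerivAt (exampleP N) ((1 + z) / z ^ (N + 1)) z := by
  obtain ⟨m, rfl⟩ := Nat.exists_eq_add_of_le hN
  have h1 : HasDerivAt (exampleW (2 + m)) (-(1 / ((2 + m : ℕ) - 1 : ℝ))) z :=
    (((hasDerivAt_id z).div_const _).const_add _).neg
  refine (h1.div (hasDerivAt_pow (2 + m) z) (by positivity)).congr_deriv ?_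
  have h2 : (((2 + m : ℕ) : ℝ) - 1) ≠ 0 := by
    push_cast
    have : (0 : ℝ) ≤ m := by positivity
    linarith
  rw [exampleW, show 2 + m - 1 = m + 1 by omega]
  push_cast at h2 ⊢
  field_simp
  ring

theorem three_le_exponent {n k : ℕ} (hn : 2 ≤ n) (hk : 2 ≤ k) : 3 ≤ (k + 1) * (n - 1) := by
  simpa using Nat.mul_le_mul (show 3 ≤ k + 1 by omega) (show 1 ≤ n - 1 by omega)

theorem isAntiderivative_example {n k : ℕ} (hn : 2 ≤ n) (hk : 2 ≤ k) :
    IsAntiderivative n (exampleF n k) (exampleP ((k + 1) * (n - 1))) := by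
  intro z hz
  have h3 := three_le_exponent hn hk
  refine (hasDerivAt_exampleP (by omega) hz).congr_deriv ?_
  have : n + k * (n - 1) = (k + 1) * (n - 1) + 1 := by
    obtain ⟨m, rfl⟩ := Nat.exists_eq_add_of_le hn
    rw [show 2 + m - 1 = m + 1 by omega]
    ring
  rw [exampleF, mul_pow, exampleG_pow hn hz.le, ← pow_mul, ← mul_assoc, ← pow_add, this]
  field_simp

theorem isNormalForm_example {n : ℕ} (hn : 2 ≤ n) (k : ℕ) :
    IsNormalForm n k (exampleF n k) (exampleP ((k + 1) * (n - 1))) 0 (exampleG n)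
      (exampleW ((k + 1) * (n - 1))) 0 where
  two_le := hn
  smooth_left := contDiffOn_exampleG n
  smooth_right := by
    unfold exampleW
    fun_prop
  eq_pow_mul _ _ := rfl
  pos _ hz := exampleG_pos n hz
  taylor := by
    have := taylorCoeff_add_pow_mul 0 k (contDiffOn_exampleG n) (F := exampleF n k) fun _ _ => rfl
    rwa [add_zero, taylorCoeff_zero] at this
  apply_zero := by
    simp only [exampleW, exampleG_zero, zero_div, add_zero, one_pow, inv_one, neg_div]
  antideriv z _ := by simp [exampleP]

theorem strictMonoOn_exampleP {N : ℕ} (hN : 2 ≤ N) :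
    StrictMonoOn (fun z => (exampleP N z ^ 2)⁻¹) (Ioi 0) := by
  have hN1 : (0 : ℝ) < (N : ℝ) - 1 := by
    have : (2 : ℝ) ≤ N := by exact_mod_cast hN
    linarith
  have hN0 : (0 : ℝ) < N := by linarith
  have hpos : ∀ z : ℝ, 0 < z → 0 < -exampleP N z := by
    intro z hz
    rw [exampleP, exampleW, neg_div, neg_neg]
    positivity
  intro z hz w hw hzw
  have hz' : (0 : ℝ) < z := hz
  have hw' : (0 : ℝ) < w := hw
  have hlt : exampleP N z < exampleP N w := by
    have hmono : StrictMonoOn (exampleP N) (Ioi 0) := by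
      refine strictMonoOn_of_deriv_pos (convex_Ioi 0)
        (fun z hz => (hasDerivAt_exampleP hN hz).continuousAt.continuousWithinAt) fun z hz => ?_
      rw [interior_Ioi] at hz
      rw [(hasDerivAt_exampleP hN hz).deriv]
      have : (0 : ℝ) < z := hz
      positivity
    exact hmono hz hw hzw
  have h1 := hpos z hz'
  have h2 := hpos w hw'
  -- The primitive is negative and increasing, so its square decreases.
  have h3 : exampleP N w ^ 2 < exampleP N z ^ 2 := by nlinarith
  have h4 : 0 < exampleP N w ^ 2 := by nlinarith
  exact inv_strictAnti₀ h4 h3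

theorem monotoneOn_mul_exampleF {n : ℕ} (hn : 2 ≤ n) (k : ℕ) :
    MonotoneOn (fun z => z * exampleF n k z) (Ioi 0) := by
  intro z hz w hw hzw
  have hz' : (0 : ℝ) < z := hz
  have hw' : (0 : ℝ) < w := hw
  have hp : (0 : ℝ) ≤ 1 - ((n : ℝ) - 1)⁻¹ := by
    have : (2 : ℝ) ≤ n := by exact_mod_cast hn
    have := inv_le_one_of_one_le₀ (show (1 : ℝ) ≤ n - 1 by linarith)
    linarith
  -- This rewrites `zF` as a product of nonnegative nondecreasing factors, the last exponent being
  -- nonnegative for `n ≥ 2`.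
  have key : ∀ z : ℝ, 0 < z → z * exampleF n k z =
      z ^ k * (z / (1 + z) * (1 + z) ^ (1 - ((n : ℝ) - 1)⁻¹)) := by
    intro z hz
    rw [exampleF, exampleG, sub_eq_add_neg 1 ((n : ℝ) - 1)⁻¹, Real.rpow_add (by positivity),
      Real.rpow_one]
    field_simp
  have h1 : z / (1 + z) ≤ w / (1 + w) := by
    rw [div_le_div_iff₀ (by positivity) (by positivity)]
    nlinarith
  simp only
  rw [key z hz', key w hw']
  gcongr

theorem isAdmissible_example {n k : ℕ} (hn : 2 ≤ n) (hk : 2 ≤ k) :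
    IsAdmissible n (exampleF n k) (exampleP ((k + 1) * (n - 1))) 0 := by
  refine ⟨(contDiff_exampleF n k).contDiffOn, fun z hz =>
    mul_pos (by positivity) (exampleG_pos n hz.le), ?_⟩
  have h3 := three_le_exponent hn hk
  have hn' : (0 : ℝ) < 2 * n - 1 := (isNormalForm_example hn k).two_mul_sub_one_pos
  have heq : ∀ z : ℝ, z * exampleF n k z *
      (1 / (2 * (n : ℝ) - 1) * exampleP ((k + 1) * (n - 1)) z + 0) ^ (-2 : ℤ) =
      (2 * n - 1) ^ 2 * (z * exampleF n k z * (exampleP ((k + 1) * (n - 1)) z ^ 2)⁻¹) := by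
    intro z
    rw [add_zero, zpow_neg, show ((1 / (2 * (n : ℝ) - 1) *
      exampleP ((k + 1) * (n - 1)) z) ^ (2 : ℤ)) = (1 / (2 * (n : ℝ) - 1) *
      exampleP ((k + 1) * (n - 1)) z) ^ 2 from zpow_ofNat _ 2, mul_pow, mul_inv]
    field_simp
  intro z hz w hw hzw
  have hz' : (0 : ℝ) < z := hz
  have hw' : (0 : ℝ) < w := hw
  simp only [heq]
  refine mul_lt_mul_of_pos_left ?_ (by positivity)
  have hF : 0 < w * exampleF n k w :=
    mul_pos hw' (mul_pos (by positivity) (exampleG_pos n hw'.le))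
  exact mul_lt_mul' (monotoneOn_mul_exampleF hn k hz hw hzw.le)
    (strictMonoOn_exampleP (by omega) hz hw hzw) (by positivity) hF

theorem exists_hasDerivWithinAt_profile_example {n k : ℕ} (hn : 2 ≤ n) (hk : 2 ≤ k) :
    ∃ d : ℝ, d ≠ 0 ∧ HasDerivWithinAt
      (profile n k (exampleG n) (exampleW ((k + 1) * (n - 1))) 0) d (Ioi 0) 0 := by
  have h3 := three_le_exponent hn hk
  have hW0 := (isNormalForm_example hn k).apply_zero_ne_zero
  set N := (k + 1) * (n - 1) with hN
  have hN3 : (3 : ℝ) ≤ N := by exact_mod_cast h3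
  have hn2 : (2 : ℝ) ≤ n := by exact_mod_cast hn
  have hG : HasDerivWithinAt (exampleG n) (-((n : ℝ) - 1)⁻¹) (Ici 0) 0 := by
    have h := ((hasDerivAt_id (0 : ℝ)).const_add 1).rpow_const (p := -((n : ℝ) - 1)⁻¹)
      (Or.inl (by simp))
    refine (h.congr_deriv (by simp)).hasDerivWithinAt
  have hG' := ((contDiffOn_Ici_derivWithin (contDiffOn_exampleG n)).differentiableOn (by simp) 0
    self_mem_Ici).hasDerivWithinAt
  have hG0 : derivWithin (exampleG n) (Ici 0) 0 = -((n : ℝ) - 1)⁻¹ :=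
    hG.derivWithin (uniqueDiffOn_Ici 0 0 self_mem_Ici)
  have hW : HasDerivWithinAt (exampleW N) (-(1 / ((N : ℝ) - 1))) (Ici 0) 0 :=
    ((((hasDerivAt_id (0 : ℝ)).div_const _).const_add _).neg).hasDerivWithinAt
  have hD := ((hG.pow (n - 2)).mul hW)
  have hne : exampleG n 0 ^ (n - 2) * exampleW N 0 ≠ 0 := by
    rw [exampleG_zero]
    simpa using hW0
  have h := ((hG.const_mul ((k : ℝ) + 1)).add ((hasDerivWithinAt_id (0 : ℝ) (Ici 0)).mul hG')).sub
    ((hasDerivWithinAt_const (0 : ℝ) (Ici 0) (2 : ℝ)).div hD hne)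
  refine ⟨_, ?_, (h.mono Ioi_subset_Ici_self).congr (fun z _ => ?_) ?_⟩
  · have hcast : ((n - 2 : ℕ) : ℝ) = n - 2 := by
      rw [Nat.cast_sub hn]
      simp
    simp only [hG0, exampleG_zero, one_pow, mul_one, one_mul, id, zero_mul, add_zero, hcast,
      Pi.mul_apply, Pi.pow_apply, exampleW, zero_div, zero_sub]
    -- Every contribution is negative: `G'(0) < 0`, and the derivative of `Gⁿ⁻² W` at `0` is
    -- `(n-2)/((n-1)N) - 1/(N-1) ≤ 1/N - 1/(N-1) < 0`.
    refine ne_of_lt ?_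
    have hn1 : (0 : ℝ) < n - 1 := by linarith
    have hx : (0 : ℝ) < ((n : ℝ) - 1)⁻¹ := inv_pos.2 hn1
    have h1 : ((n : ℝ) - 2) * ((n : ℝ) - 1)⁻¹ ≤ 1 := by
      rw [← div_eq_mul_inv, div_le_one hn1]
      linarith
    have h2 : (1 : ℝ) / N < 1 / (N - 1) := one_div_lt_one_div_of_lt (by linarith) (by linarith)
    have hN1 : (0 : ℝ) < 1 / N := by positivity
    have h4 := mul_le_mul_of_nonneg_right h1 hN1.le
    have h5 : 0 < -(2 * (((n : ℝ) - 2) * -((n : ℝ) - 1)⁻¹ * -(1 / (N : ℝ)) +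
        -(1 / ((N : ℝ) - 1)))) / (-(1 / (N : ℝ))) ^ 2 := by
      rw [neg_sq]
      refine div_pos ?_ (by positivity)
      linarith
    have h6 : ((k : ℝ) + 1) * -((n : ℝ) - 1)⁻¹ < 0 :=
      mul_neg_of_pos_of_neg (by positivity) (by linarith)
    linarith
  · simp [profile]
  · simp [profile]

end Klsc

theorem theorem3 (n k : ℕ) (hn : 2 ≤ n) :
    (∀ (F P : ℝ → ℝ) (C : ℝ),
      ContDiff ℝ ∞ (fun x : Klsc.Cn n => F (Klsc.radial x)) →
      Klsc.HasOrder F k →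
      Klsc.IsAntiderivative n F P →
      Klsc.IsAdmissible n F P C →
      -- the cone-like singularity, in the new radial variable `r`
      (Klsc.IsRadialChange (Klsc.coneRadius n k F) ∧
        ∃ a b c : ℝ → ℝ,
          Klsc.IsConeExpansion n k (Klsc.metric n F P C) (Klsc.coneRadius n k F) a b c ∧
          a =o[𝓝[>] (0 : ℝ)] (fun _ => (1 : ℝ)) ∧
          b =o[𝓝[>] (0 : ℝ)] (fun r => r ^ 2) ∧
          c =o[𝓝[>] (0 : ℝ)] (fun r => r ^ 2) ∧
          (¬ (n = 2 ∧ k = 0) →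
            a =O[𝓝[>] (0 : ℝ)] (fun r => r ^ (2 / ((k : ℝ) + 1))) ∧
            b =O[𝓝[>] (0 : ℝ)] (fun r => r ^ (2 * ((k : ℝ) + 2) / ((k : ℝ) + 1)))) ∧
          c =O[𝓝[>] (0 : ℝ)] (fun r => r ^ (2 * ((k : ℝ) + 2) / ((k : ℝ) + 1)))) ∧
      -- the regularity over the origin when `k = 0` or `k = 1`
      (k = 0 ∨ k = 1 →
        (Klsc.obstruction n k F = 0 →
          Klsc.HasClass n k (Klsc.metric n F P C) (Klsc.coneRadius n k F) ⊤) ∧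
        (Klsc.obstruction n k F ≠ 0 →
          Klsc.HasClass n k (Klsc.metric n F P C) (Klsc.coneRadius n k F) ((2 * n - 3 : ℕ) : ℕ∞) ∧
          ¬ Klsc.HasClass n k (Klsc.metric n F P C) (Klsc.coneRadius n k F)
              ((2 * n - 2 : ℕ) : ℕ∞))) ∧
      -- the regularity over the origin when `k ≥ 2`
      (2 ≤ k → Klsc.HasClass n k (Klsc.metric n F P C) (Klsc.coneRadius n k F) 0)) ∧
    -- for `k ≥ 2` no better class can be guaranteed a priori
    (2 ≤ k → ∃ (F P : ℝ → ℝ) (C : ℝ),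
      ContDiff ℝ ∞ (fun x : Klsc.Cn n => F (Klsc.radial x)) ∧
      Klsc.HasOrder F k ∧
      Klsc.IsAntiderivative n F P ∧
      Klsc.IsAdmissible n F P C ∧
      ¬ Klsc.HasClass n k (Klsc.metric n F P C) (Klsc.coneRadius n k F) 1) := by
  refine ⟨fun F P C hF hk hP hadm => ?_, fun hk => ?_⟩
  · obtain ⟨G, W, h⟩ := Klsc.exists_isNormalForm hn C (Klsc.contDiffOn_Ici_of_comp_radial hn hF)
      hk hP hadm.2.1
    refine ⟨⟨h.isRadialChange, _, _, _, h.isConeExpansion, h.isLittleO_radialRemainder,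
      Klsc.isLittleO_const_mul_sq_mul _
        ((Asymptotics.isLittleO_one_iff ℝ).1 h.isLittleO_radialRemainder),
      h.isLittleO_projectiveRemainder,
      fun hnk => ⟨h.isBigO_radialRemainder hnk, h.isBigO_hopfRemainder hnk⟩,
      h.isBigO_projectiveRemainder⟩, fun hk' => ⟨fun hob => ?_, fun hob => ⟨?_, ?_⟩⟩,
      fun _ => h.hasClass_zero⟩
    · rw [hob, zero_div] at h
      exact h.hasClass_top hk'
    · exact h.hasClass_of_le_one hk'
    · exact h.not_hasClass hk' (div_ne_zero hob (by positivity))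
  · obtain ⟨d, hd0, hd⟩ := Klsc.exists_hasDerivWithinAt_profile_example hn hk
    refine ⟨Klsc.exampleF n k, _, 0, Klsc.contDiff_exampleF n k,
      Klsc.hasOrder_of_eq_pow_mul (Klsc.contDiffOn_exampleG n) (fun _ _ => rfl)
        (by simp [Klsc.exampleG_zero]), Klsc.isAntiderivative_example hn hk,
      Klsc.isAdmissible_example hn hk,
      (Klsc.isNormalForm_example hn k).not_hasClass_one hk hd hd0⟩
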